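/- Let $d\ge 1$, $p\in(0,+\infty]$, and for $x\in\mathbb{R}^d$ put $|x|_{p,d}=\big(\sum_{j=1}^d|x_j|^p\big)^{1/p}$ if $p<\infty$ and $|x|_{\infty,d}=\max_{1\le j\le d}|x_j|$. Let $A(\mathbb{R}^d)$ be the set of functions $f:\mathbb{R}^d\to\mathbb{C}$ of the form $$f(x)=\int_{\mathbb{R}^d}g(y)e^{-i(x,y)}\,dy\quad\text{for all }x\in\mathbb{R}^d,\qquad g\in L_1(\mathbb{R}^d),$$ where $(x,y)=\sum_{j=1}^d x_jy_j$. Let $\alpha\ge 0$, let $\beta,\gamma\in\mathbb{R}$, and let $$f_0(t)=\frac{t^\gamma}{(1+t^\alpha)^\beta}$$ for $t\ge 0$ (with $0^0=1$; if $\gamma<0$, the formula is used for $t>0$ only and $f_0(0)$ may be any real number). Then the function $x\mapsto f_0(|x|_{p,d})$ belongs to $A(\mathbb{R}^d)$ if and only if $\alpha>0$ and $\alpha\beta>\gamma\ge 0$. -/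

import Mathlib

noncomputable section

/-- The quantity `|x|_{p,d}` for `p ∈ (0, ∞]`: `(∑ⱼ |xⱼ|^p)^(1/p)` for finite `p`, and
`maxⱼ |xⱼ|` for `p = ∞`. -/
def lpAbs {d : ℕ} (p : ENNReal) (x : EuclideanSpace ℝ (Fin d)) : ℝ :=
  if p = ⊤ then ⨆ j, |x j| else (∑ j, |x j| ^ p.toReal) ^ (1 / p.toReal)

/-- The Wiener algebra `A(ℝ^d)`: the functions which are, at every point `x`, the Fourier transform
`∫ g(y) e^{-i(x,y)} dy` of a function `g ∈ L₁(ℝ^d)`. -/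
def wienerAlgebra (d : ℕ) : Set (EuclideanSpace ℝ (Fin d) → ℂ) :=
  {f | ∃ g : EuclideanSpace ℝ (Fin d) → ℂ, MeasureTheory.Integrable g ∧
    ∀ x, f x = ∫ y, g y * Complex.exp (-(Complex.I * (inner ℝ x y : ℝ)))}

end

/-! Necessity. A Fourier transform of an integrable function is bounded and, by Riemann–Lebesgue,
vanishes at infinity. On a coordinate axis the function is `t^γ / (1 + t^α)^β`: boundedness near `0`
forces `γ ≥ 0`, decay at infinity forces `γ < αβ`, and then `α ≠ 0`.

Sufficiency. Taylor's formula expanded at infinity writes a profile as `F(u) = c ∫ v^m F^(m+1)(v) (1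
- u/v)_+^m dv` over `v > 0`. With `u = ρ(x)` for a homogeneous `ρ`, this is a superposition of
dilates of `(1 - ρ)_+^m`. Dilation of a transform does not change the `L₁` norm of its preimage, so
it suffices that the weight `v^m F^(m+1)` is integrable and that one truncated power lies in the
algebra (`isWiener_powerProfile_comp`). The weight is integrable because `t^k |F^(k)(t)|` is bounded
by a profile `t^a (1 + t^α)^(-b)` with `0 < a < αb`, which is integrable against `dt/t`.

For `p = ∞`, take `ρ = max |x_j|` and `m = 1` (`isWiener_cubeTent`). The transform of the tent is an
average over `s ∈ (0, 1]` of products of `sin(s ξ_j) / ξ_j`, and a weighted `L₂` bound shows that it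
is integrable.

For `p < ∞`, take `ρ = ∑ |x_j|^p` and `m = 2d + 1` (`isWiener_truncated_pow_sum`). Laplace inversion
on `Re z = 1` expresses `(1 - ρ)_+^m` through `e^{-zρ} = ∏ e^{-z|x_j|^p}`. Taylor's formula and the
one-dimensional tent give each factor a preimage of `L₁` norm `O(|z|²)`, and the kernel `z^{-(m+1)}`
absorbs the product. -/

open MeasureTheory Filter Topology Set

/-! ### Fourier transforms of integrable functions and superpositions of their dilates -/

section Wiener

variable {V : Type*} [NormedAddCommGroup V] [InnerProductSpace ℝ V]

/-- The character `y ↦ e^{-i(x,y)}`. -/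
noncomputable def wienerChar (x y : V) : ℂ := Complex.exp (-(Complex.I * (inner ℝ x y : ℝ)))

lemma norm_wienerChar (x y : V) : ‖wienerChar x y‖ = 1 := by
  rw [wienerChar, Complex.norm_exp]; simp

lemma continuous_wienerChar_right (x : V) : Continuous fun y : V => wienerChar x y := by
  unfold wienerChar; fun_prop

variable [MeasurableSpace V] [BorelSpace V] [FiniteDimensional ℝ V]

/-- `f` is the Fourier transform of an integrable function, at every point. -/
def IsWiener (f : V → ℂ) : Prop :=
  ∃ g : V → ℂ, Integrable g ∧ ∀ x, f x = ∫ y, g y * wienerChar x y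

lemma IsWiener.exists_stronglyMeasurable {f : V → ℂ} (hf : IsWiener f) :
    ∃ g : V → ℂ, StronglyMeasurable g ∧ Integrable g ∧ ∀ x, f x = ∫ y, g y * wienerChar x y := by
  obtain ⟨g, hg, h⟩ := hf
  refine ⟨hg.1.mk g, hg.1.stronglyMeasurable_mk, hg.congr hg.1.ae_eq_mk, fun x => ?_⟩
  rw [h x]
  refine integral_congr_ae ?_
  filter_upwards [hg.1.ae_eq_mk] with y hy
  rw [hy]

lemma IsWiener.bounded {f : V → ℂ} (hf : IsWiener f) : ∃ C : ℝ, ∀ x, ‖f x‖ ≤ C := by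
  obtain ⟨g, hg, h⟩ := hf
  refine ⟨∫ y, ‖g y‖, fun x => ?_⟩
  rw [h x]
  refine (norm_integral_le_integral_norm _).trans (le_of_eq ?_)
  simp [norm_wienerChar]

/-- Riemann–Lebesgue; the rescaling by `(2π)⁻¹` passes from the kernel `e^{-2πi(x,y)}` to
`e^{-i(x,y)}`. -/
lemma IsWiener.tendsto_zero {f : V → ℂ} (hf : IsWiener f) :
    Tendsto f (cocompact V) (𝓝 0) := by
  obtain ⟨g, hg, h⟩ := hf
  have h1 := tendsto_integral_exp_inner_smul_cocompact (V := V) g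
  have hpi : (2 * Real.pi)⁻¹ ≠ 0 := by positivity
  have h2 : Tendsto (fun x : V => (2 * Real.pi)⁻¹ • x) (cocompact V) (cocompact V) :=
    (Homeomorph.smulOfNeZero _ hpi).isClosedEmbedding.tendsto_cocompact
  refine (h1.comp h2).congr fun x => ?_
  rw [h x]
  refine integral_congr_ae (ae_of_all _ fun y => ?_)
  simp only [Circle.smul_def, Real.fourierChar_apply, smul_eq_mul, wienerChar]
  rw [mul_comm, inner_smul_right, real_inner_comm]
  congr 2
  push_cast
  field_simp

/-- A superposition of Fourier transforms is the Fourier transform of the superposition. -/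
lemma integral_integral_mul_wienerChar {T : Type*} [MeasurableSpace T] {μ : Measure T} [SFinite μ]
    {g : T → V → ℂ} (hg : Integrable (Function.uncurry g) (μ.prod volume)) (x : V) :
    ∫ t, (∫ y, g t y * wienerChar x y) ∂μ = ∫ y, (∫ t, g t y ∂μ) * wienerChar x y := by
  have h : Integrable (Function.uncurry fun t y => g t y * wienerChar x y) (μ.prod volume) :=
    hg.mul_bdd (c := 1) (((continuous_wienerChar_right x).stronglyMeasurable.comp_measurable
      measurable_snd).aestronglyMeasurable) (ae_of_all _ fun y => (norm_wienerChar x y.2).le)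
  rw [integral_integral_swap h]
  simp_rw [integral_mul_const]

lemma isWiener_of_integrable_fourier {F : V → ℂ} (hc : Continuous F) (hi : Integrable F)
    (hF : Integrable (FourierTransform.fourier F)) : IsWiener F := by
  have hpi : (-(2 * Real.pi)⁻¹) ≠ 0 := neg_ne_zero.mpr (by positivity)
  have key := hc.fourierInv_fourier_eq hi hF
  set c : ℝ := |((-(2 * Real.pi)⁻¹) ^ Module.finrank ℝ V)⁻¹| with hcdef
  have hc0 : c ≠ 0 := by rw [hcdef]; positivity
  -- Substitute `v = -y / (2π)` in the inversion formula; `c` is the Jacobian.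
  refine ⟨fun y => (c : ℂ)⁻¹ * FourierTransform.fourier F ((-(2 * Real.pi)⁻¹) • y),
    (hF.comp_smul hpi).const_mul _, fun x => ?_⟩
  have h1 := Measure.integral_comp_smul (volume : Measure V)
    (fun v => Complex.exp (↑(2 * Real.pi * inner ℝ v x) * Complex.I) • FourierTransform.fourier F v)
    (-(2 * Real.pi)⁻¹)
  rw [← Real.fourierInv_eq', key, ← hcdef] at h1
  have h2 : F x = (c : ℂ)⁻¹ * (c • F x) := by
    rw [Complex.real_smul, inv_mul_cancel_left₀ (by exact_mod_cast hc0)]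
  rw [h2, ← h1, ← integral_const_mul]
  refine integral_congr_ae (ae_of_all _ fun y => ?_)
  simp only [smul_eq_mul, wienerChar]
  rw [mul_comm (Complex.exp _), ← mul_assoc, inner_smul_left, real_inner_comm]
  congr 2
  simp only [map_neg, conj_trivial]
  push_cast
  field_simp

/-- Superpositions of dilates of one Fourier transform of an integrable function, with weights
depending on a parameter. -/
lemma IsWiener.superposition_dilates {Φ : V → ℂ} (hΦ : IsWiener Φ) {S T : Type*} [MeasurableSpace S]
    [MeasurableSpace T] {μ : Measure T} [SFinite μ] {w : S → T → ℂ} (hw : ∀ a, Integrable (w a) μ)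
    {σ : T → ℝ} (hσ : Measurable σ) (hpos : ∀ᵐ t ∂μ, 0 < σ t) :
    ∃ g : S → V → ℂ, (∀ a, Integrable (g a)) ∧
      (∀ a x, ∫ t, w a t * Φ ((σ t)⁻¹ • x) ∂μ = ∫ y, g a y * wienerChar x y) ∧
      (StronglyMeasurable (Function.uncurry w) → StronglyMeasurable (Function.uncurry g)) ∧
      ∃ C : ℝ, ∀ a, ∫ y, ‖g a y‖ ≤ C * ∫ t, ‖w a t‖ ∂μ := by
  obtain ⟨g, hgm, hg, h⟩ := hΦ.exists_stronglyMeasurable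
  set n := Module.finrank ℝ V
  -- The dilate `σ^n g(σ y)` has transform `Φ(x / σ)` and the same `L₁` norm as `g`, so only the
  -- integrability of the weight matters.
  set G : S → T → V → ℂ := fun a t y => w a t * ((σ t ^ n : ℝ) * g (σ t • y))
  have hdil : StronglyMeasurable fun q : T × V => ((σ q.1 ^ n : ℝ) : ℂ) * g (σ q.1 • q.2) := by
    refine StronglyMeasurable.mul ?_ ?_
    · exact (Complex.measurable_ofReal.comp
        ((hσ.comp measurable_fst).pow_const n)).stronglyMeasurable
    · exact hgm.comp_measurable ((hσ.comp measurable_fst).smul measurable_snd)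
  have hnorm : ∀ a, ∀ t, 0 < σ t → ∫ y, ‖G a t y‖ = ‖w a t‖ * ∫ y, ‖g y‖ := by
    intro a t ht
    simp only [G, norm_mul, integral_const_mul]
    rw [Measure.integral_comp_smul volume (fun y => ‖g y‖), Complex.norm_real,
      Real.norm_of_nonneg (by positivity), abs_of_pos (by positivity), smul_eq_mul,
      mul_inv_cancel_left₀ (by positivity)]
  have hi : ∀ a, Integrable (Function.uncurry (G a)) (μ.prod volume) := by
    intro a
    have hm : AEStronglyMeasurable (Function.uncurry (G a)) (μ.prod volume) :=
      ((hw a).1.comp_fst (ν := (volume : Measure V))).mul hdil.aestronglyMeasurable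
    rw [integrable_prod_iff hm]
    refine ⟨?_, ?_⟩
    · filter_upwards [hpos] with t ht
      exact ((hg.comp_smul ht.ne').const_mul ((σ t ^ n : ℝ) : ℂ)).const_mul (w a t)
    · refine ((hw a).norm.mul_const (∫ y, ‖g y‖)).congr ?_
      filter_upwards [hpos] with t ht
      exact (hnorm a t ht).symm
  refine ⟨fun a y => ∫ t, G a t y ∂μ, fun a => (hi a).integral_prod_right, fun a x => ?_,
    fun hwm => ?_, ∫ y, ‖g y‖, fun a => ?_⟩
  · rw [← integral_integral_mul_wienerChar (hi a)]
    refine integral_congr_ae ?_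
    filter_upwards [hpos] with t ht
    have h1 := Measure.integral_comp_smul (volume : Measure V)
      (fun y => g y * wienerChar ((σ t)⁻¹ • x) y) (σ t)
    have h2 : ∀ y, wienerChar ((σ t)⁻¹ • x) (σ t • y) = wienerChar x y := fun y => by
      rw [wienerChar, wienerChar, inner_smul_left, inner_smul_right]
      simp [ht.ne']
    simp only [h2, ← h, abs_of_pos (inv_pos.mpr (pow_pos ht _))] at h1
    simp only [G, mul_assoc, integral_const_mul]
    rw [h1, Complex.real_smul]
    push_cast
    rw [mul_inv_cancel_left₀ (by exact_mod_cast (pow_pos ht _).ne')]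
  · have h1 : StronglyMeasurable fun q : (S × V) × T => G q.1.1 q.2 q.1.2 :=
      (hwm.comp_measurable (g := fun q : (S × V) × T => (q.1.1, q.2)) (by fun_prop)).mul
        (hdil.comp_measurable (g := fun q : (S × V) × T => (q.2, q.1.2)) (by fun_prop))
    exact h1.integral_prod_right'
  · have h1 : ∫ y, ‖∫ t, G a t y ∂μ‖ ≤ ∫ y, ∫ t, ‖G a t y‖ ∂μ := by
      refine integral_mono (hi a).integral_prod_right.norm (hi a).norm.integral_prod_right fun y => ?_
      exact norm_integral_le_integral_norm _
    refine h1.trans (le_of_eq ?_)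
    rw [← integral_integral_swap (f := fun t y => ‖G a t y‖) (hi a).norm, mul_comm,
      ← integral_mul_const]
    refine integral_congr_ae ?_
    filter_upwards [hpos] with t ht using hnorm a t ht

end Wiener

/-! ### One-dimensional oscillatory integrals -/

/-- Second mean value estimate for a decreasing amplitude. -/
lemma abs_integral_cos_mul_le {φ φ' : ℝ → ℝ} {a N b : ℝ} (haN : a ≤ N) (hb : 0 < b)
    (hd : ∀ x ∈ Icc a N, HasDerivAt φ (φ' x) x) (hc : ContinuousOn φ' (Icc a N))
    (hneg : ∀ x ∈ Icc a N, φ' x ≤ 0) (hpos : ∀ x ∈ Icc a N, 0 ≤ φ x) :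
    |∫ x in a..N, Real.cos (b * x) * φ x| ≤ 2 * φ a / b := by
  have hu : uIcc a N = Icc a N := uIcc_of_le haN
  have hi : IntervalIntegrable φ' volume a N := (hu ▸ hc).intervalIntegrable
  have hs : ∀ x ∈ uIcc a N, HasDerivAt (fun x => Real.sin (b * x) / b) (Real.cos (b * x)) x := by
    intro x _
    have h : HasDerivAt (fun x => b * x) b x := by simpa using (hasDerivAt_id x).const_mul b
    simpa [hb.ne'] using h.sin.div_const b
  have h1 := intervalIntegral.integral_mul_deriv_eq_deriv_mul (u := φ) (u' := φ')
    (fun x hx => hd x (hu ▸ hx)) hs hi (by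
      apply Continuous.intervalIntegrable; fun_prop)
  have h2 : ∫ x in a..N, φ' x = φ N - φ a :=
    intervalIntegral.integral_eq_sub_of_hasDerivAt (fun x hx => hd x (hu ▸ hx)) hi
  have h3 : |∫ x in a..N, φ' x * (Real.sin (b * x) / b)| ≤ ∫ x in a..N, -(φ' x) * b⁻¹ := by
    rw [← Real.norm_eq_abs]
    refine intervalIntegral.norm_integral_le_of_norm_le haN (ae_of_all _ fun x hx => ?_)
      (hi.neg.mul_const b⁻¹)
    have hx' : x ∈ Icc a N := ⟨hx.1.le, hx.2⟩
    rw [norm_mul, Real.norm_eq_abs, abs_of_nonpos (hneg x hx'), Real.norm_eq_abs, abs_div,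
      abs_of_pos hb, div_eq_mul_inv]
    gcongr
    · linarith [hneg x hx']
    · exact mul_le_of_le_one_left (by positivity) (Real.abs_sin_le_one _)
  rw [intervalIntegral.integral_mul_const, intervalIntegral.integral_neg, h2] at h3
  have h4 : ∀ x ∈ Icc a N, |φ x * (Real.sin (b * x) / b)| ≤ φ x * b⁻¹ := by
    intro x hx
    rw [abs_mul, abs_of_nonneg (hpos x hx), abs_div, abs_of_pos hb, div_eq_mul_inv]
    have := hpos x hx
    gcongr
    exact mul_le_of_le_one_left (by positivity) (Real.abs_sin_le_one _)
  have h5 := h4 a ⟨le_rfl, haN⟩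
  have h6 := h4 N ⟨haN, le_rfl⟩
  simp_rw [mul_comm (Real.cos _)]
  rw [h1]
  have e : 2 * φ a / b = φ N * b⁻¹ + φ a * b⁻¹ + -(φ N - φ a) * b⁻¹ := by
    rw [div_eq_mul_inv]; ring
  rw [e]
  exact (abs_sub _ _).trans (add_le_add ((abs_sub _ _).trans (add_le_add h6 h5)) h3)

lemma continuous_one_add_abs_rpow (c : ℝ) : Continuous fun x : ℝ => (1 + |x|) ^ c := by
  refine Continuous.rpow_const (by fun_prop) fun x => Or.inl ?_
  positivity

/-- Split at `1/b`. Below it the cosine does not oscillate and the amplitude is dominated by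
`x^(ε-1)`, which integrates to at most `b^(-ε) / ε`; above it the second mean value estimate gives
`2 b^(-ε)`. The bound is uniform in `N`. -/
lemma abs_integral_cos_mul_rpow_le {ε : ℝ} (h0 : 0 < ε) (h1 : ε < 1) {b N : ℝ} (hb : 0 < b)
    (hN : 0 ≤ N) :
    |∫ x in (0 : ℝ)..N, Real.cos (b * x) * (1 + |x|) ^ (ε - 1)| ≤ (1 / ε + 2) * b ^ (-ε) := by
  have hcont : Continuous fun x : ℝ => Real.cos (b * x) * (1 + |x|) ^ (ε - 1) :=
    (by fun_prop : Continuous fun x : ℝ => Real.cos (b * x)).mul (continuous_one_add_abs_rpow _)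
  have hbε : 0 < b ^ (-ε) := Real.rpow_pos_of_pos hb _
  have hinv : (b⁻¹) ^ ε = b ^ (-ε) := by rw [Real.inv_rpow hb.le, Real.rpow_neg hb.le]
  have small : ∀ M : ℝ, 0 ≤ M → M ≤ b⁻¹ →
      |∫ x in (0 : ℝ)..M, Real.cos (b * x) * (1 + |x|) ^ (ε - 1)| ≤ 1 / ε * b ^ (-ε) := by
    intro M hM hMb
    have h2 : |∫ x in (0 : ℝ)..M, Real.cos (b * x) * (1 + |x|) ^ (ε - 1)|
        ≤ ∫ x in (0 : ℝ)..M, x ^ (ε - 1) := by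
      rw [← Real.norm_eq_abs]
      refine intervalIntegral.norm_integral_le_of_norm_le hM (ae_of_all _ fun x hx => ?_)
        (intervalIntegral.intervalIntegrable_rpow' (by linarith))
      have hx0 : 0 < x := hx.1
      rw [norm_mul, Real.norm_eq_abs, Real.norm_eq_abs, abs_of_pos hx0,
        abs_of_nonneg (by positivity : (0 : ℝ) ≤ (1 + x) ^ (ε - 1))]
      refine (mul_le_of_le_one_left (by positivity) (Real.abs_cos_le_one _)).trans ?_
      exact Real.rpow_le_rpow_of_nonpos hx0 (by linarith) (by linarith)
    rw [integral_rpow (Or.inl (by linarith))] at h2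
    refine h2.trans ?_
    simp only [sub_add_cancel, Real.zero_rpow h0.ne', sub_zero]
    rw [div_eq_mul_inv, mul_comm, one_div]
    gcongr
    rw [← hinv]
    exact Real.rpow_le_rpow hM hMb h0.le
  rcases le_total N b⁻¹ with h | h
  · refine (small N hN h).trans ?_
    gcongr; linarith
  · have hb' : 0 < b⁻¹ := inv_pos.mpr hb
    rw [← intervalIntegral.integral_add_adjacent_intervals (b := b⁻¹)
      (hcont.intervalIntegrable _ _) (hcont.intervalIntegrable _ _), add_mul]
    refine (abs_add_le _ _).trans (add_le_add (small _ hb'.le le_rfl) ?_)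
    have h3 : ∫ x in b⁻¹..N, Real.cos (b * x) * (1 + |x|) ^ (ε - 1)
        = ∫ x in b⁻¹..N, Real.cos (b * x) * (1 + x) ^ (ε - 1) := by
      refine intervalIntegral.integral_congr fun x hx => ?_
      rw [uIcc_of_le h] at hx
      simp only [abs_of_nonneg (hb'.le.trans hx.1)]
    rw [h3]
    refine (abs_integral_cos_mul_le (φ := fun x => (1 + x) ^ (ε - 1))
      (φ' := fun x => (ε - 1) * (1 + x) ^ (ε - 1 - 1)) h hb (fun x hx => ?_) ?_
      (fun x hx => ?_) (fun x hx => ?_)).trans ?_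
    · have hx0 : 0 < 1 + x := by linarith [hx.1]
      have := ((hasDerivAt_id x).const_add 1).rpow_const (p := ε - 1) (Or.inl hx0.ne')
      simpa using this
    · refine continuousOn_const.mul (ContinuousOn.rpow_const (by fun_prop) fun x hx => Or.inl ?_)
      have : 0 < 1 + x := by linarith [hx.1]
      exact this.ne'
    · have hx0 : 0 < 1 + x := by linarith [hx.1]
      exact mul_nonpos_of_nonpos_of_nonneg (by linarith) (by positivity)
    · have hx0 : 0 < 1 + x := by linarith [hx.1]
      positivity
    · have h4 : (1 + b⁻¹) ^ (ε - 1) ≤ b⁻¹ ^ (ε - 1) :=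
        Real.rpow_le_rpow_of_nonpos hb' (by linarith) (by linarith)
      rw [mul_div_assoc, div_eq_mul_inv]
      gcongr
      rw [← hinv]
      calc (1 + b⁻¹) ^ (ε - 1) * b⁻¹ ≤ b⁻¹ ^ (ε - 1) * b⁻¹ := by gcongr
        _ = b⁻¹ ^ ε := by rw [← Real.rpow_add_one hb'.ne', sub_add_cancel]

/-- The function `x ↦ sin (s x) / x`, extended by continuity. -/
noncomputable def dirichletSine (s x : ℝ) : ℝ := s * Real.sinc (s * x)

lemma continuous_dirichletSine : Continuous fun q : ℝ × ℝ => dirichletSine q.1 q.2 := by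
  unfold dirichletSine; fun_prop

lemma mul_dirichletSine (s x : ℝ) : x * dirichletSine s x = Real.sin (s * x) := by
  unfold dirichletSine
  by_cases h : s * x = 0
  · rcases mul_eq_zero.mp h with h | h <;> simp [h]
  · rw [Real.sinc_of_ne_zero h]
    have := (mul_ne_zero_iff.mp h)
    field_simp [this.1, this.2]

lemma abs_dirichletSine_le (s x : ℝ) : |dirichletSine s x| ≤ |s| := by
  unfold dirichletSine
  rw [abs_mul]
  exact mul_le_of_le_one_right (abs_nonneg _) (Real.abs_sinc_le_one _)

lemma dirichletSine_neg (s x : ℝ) : dirichletSine s (-x) = dirichletSine s x := by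
  simp [dirichletSine]

lemma abs_dirichletSine_mul_le {s t : ℝ} (hs : |s| ≤ 1) (ht : |t| ≤ 1) (x : ℝ) :
    |dirichletSine s x * dirichletSine t x| * (1 + x ^ 2) ≤ 2 := by
  have h1 : |dirichletSine s x * dirichletSine t x| ≤ 1 := by
    rw [abs_mul]
    exact mul_le_one₀ ((abs_dirichletSine_le s x).trans hs) (abs_nonneg _)
      ((abs_dirichletSine_le t x).trans ht)
  have h2 : |dirichletSine s x * dirichletSine t x| * x ^ 2 ≤ 1 := by
    have : |dirichletSine s x * dirichletSine t x| * x ^ 2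
        = |Real.sin (s * x)| * |Real.sin (t * x)| := by
      rw [← mul_dirichletSine, ← mul_dirichletSine, ← sq_abs x, abs_mul, abs_mul, abs_mul]; ring
    rw [this]
    exact mul_le_one₀ (Real.abs_sin_le_one _) (abs_nonneg _) (Real.abs_sin_le_one _)
  linarith

/-- The weight `(1 + x²) (1 + |x|)^(ε - 1)`. -/
noncomputable def sineWeight (ε x : ℝ) : ℝ := (1 + x ^ 2) * (1 + |x|) ^ (ε - 1)

lemma continuous_sineWeight (ε : ℝ) : Continuous (sineWeight ε) :=
  (by fun_prop : Continuous fun x : ℝ => 1 + x ^ 2).mul (continuous_one_add_abs_rpow _)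

lemma sineWeight_pos (ε x : ℝ) : 0 < sineWeight ε x := by
  unfold sineWeight; positivity

lemma integrable_inv_sineWeight {ε : ℝ} (hε : 0 < ε) : Integrable fun x => (sineWeight ε x)⁻¹ := by
  have h := (integrable_one_add_norm (E := ℝ) (μ := volume) (r := 1 + ε)
    (by simp; exact hε)).const_mul 2
  refine h.mono' ((continuous_sineWeight ε).inv₀
    fun x => (sineWeight_pos ε x).ne').aestronglyMeasurable (ae_of_all _ fun x => ?_)
  rw [Real.norm_of_nonneg (inv_pos.mpr (sineWeight_pos ε x)).le, Real.norm_eq_abs,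
    inv_le_comm₀ (sineWeight_pos ε x) (by positivity)]
  have h2 : (1 + |x|) ^ (-(1 + ε)) = ((1 + |x|) ^ 2 * (1 + |x|) ^ (ε - 1))⁻¹ := by
    rw [← Real.rpow_natCast, ← Real.rpow_add (by positivity), ← Real.rpow_neg (by positivity)]
    congr 1; push_cast; ring
  rw [h2, mul_inv, inv_inv, sineWeight, ← mul_assoc]
  gcongr
  -- The factor `2` comes from `(1 + |x|)² ≤ 2 (1 + x²)`.
  nlinarith [sq_nonneg (1 - |x|), sq_abs x]

lemma abs_dirichletSine_mul_sineWeight_le {ε s t : ℝ} (hε : ε < 1) (hs : |s| ≤ 1) (ht : |t| ≤ 1)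
    (x : ℝ) : |dirichletSine s x * dirichletSine t x * sineWeight ε x| ≤ 2 := by
  rw [abs_mul, abs_of_pos (sineWeight_pos ε x), sineWeight, ← mul_assoc]
  have h : (1 + |x|) ^ (ε - 1) ≤ 1 :=
    Real.rpow_le_one_of_one_le_of_nonpos (by linarith [abs_nonneg x]) (by linarith)
  calc _ ≤ 2 * (1 : ℝ) := mul_le_mul (abs_dirichletSine_mul_le hs ht x) h (by positivity) (by simp)
    _ = 2 := by ring

/-- In the factor `1 + x²` of the weight, the `1` gives an absolutely convergent integral. The `x²`
cancels both denominators and leaves `sin(sx) sin(tx)`, a difference of cosines of frequencies `|s -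
t| ≤ s + t`, each controlled by the cosine estimate. -/
lemma abs_integral_dirichletSine_mul_le {ε : ℝ} (h0 : 0 < ε) (h1 : ε < 1) {s t N : ℝ}
    (hs : s ∈ Icc (0 : ℝ) 1) (ht : t ∈ Icc (0 : ℝ) 1) (hst : s ≠ t) (hN : 0 ≤ N) :
    |∫ x in (-N)..N, dirichletSine s x * dirichletSine t x * sineWeight ε x|
      ≤ (2 * Real.pi + 2 * (1 / ε + 2)) * |s - t| ^ (-ε) := by
  have hs' : |s| ≤ 1 := abs_le.mpr ⟨by linarith [hs.1], hs.2⟩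
  have ht' : |t| ≤ 1 := abs_le.mpr ⟨by linarith [ht.1], ht.2⟩
  have hcd : ∀ r, Continuous (dirichletSine r) := fun r =>
    continuous_dirichletSine.comp (by fun_prop : Continuous fun x : ℝ => (r, x))
  have hce := continuous_one_add_abs_rpow (ε - 1)
  set P : ℝ → ℝ := fun x => dirichletSine s x * dirichletSine t x * sineWeight ε x
  have hP : Continuous P := ((hcd s).mul (hcd t)).mul (continuous_sineWeight ε)
  have heven : ∫ x in (-N)..N, P x = 2 * ∫ x in (0 : ℝ)..N, P x := by
    rw [← intervalIntegral.integral_add_adjacent_intervals (b := 0)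
      (hP.intervalIntegrable _ _) (hP.intervalIntegrable _ _)]
    have : ∫ x in (-N)..0, P x = ∫ x in (0 : ℝ)..N, P x := by
      rw [← neg_zero, ← intervalIntegral.integral_comp_neg, neg_zero]
      refine intervalIntegral.integral_congr fun x _ => ?_
      simp [P, dirichletSine_neg, sineWeight]
    rw [this]; ring
  set A : ℝ → ℝ := fun x => dirichletSine s x * dirichletSine t x * (1 + |x|) ^ (ε - 1)
  set B : ℝ → ℝ → ℝ := fun b x => Real.cos (b * x) * (1 + |x|) ^ (ε - 1)
  have hA : Continuous A := ((hcd s).mul (hcd t)).mul hce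
  have hB : ∀ b, Continuous (B b) := fun b =>
    (by fun_prop : Continuous fun x : ℝ => Real.cos (b * x)).mul hce
  have hdec : ∀ x, P x = A x + (1 / 2) * (B |s - t| x - B (s + t) x) := by
    intro x
    have e1 : Real.cos (|s - t| * x) = Real.cos (s * x - t * x) := by
      rcases abs_choice (s - t) with h | h <;> rw [h]
      · congr 1; ring
      · rw [← Real.cos_neg]; congr 1; ring
    have e2 : Real.cos ((s + t) * x) = Real.cos (s * x + t * x) := by congr 1; ring
    have e3 := mul_dirichletSine s x
    have e4 := mul_dirichletSine t x
    simp only [P, A, B, sineWeight, e1, e2, Real.cos_sub, Real.cos_add, ← e3, ← e4]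
    ring
  have hint : ∫ x in (0 : ℝ)..N, P x = (∫ x in (0 : ℝ)..N, A x)
      + (1 / 2) * ((∫ x in (0 : ℝ)..N, B |s - t| x) - ∫ x in (0 : ℝ)..N, B (s + t) x) := by
    have hBB : Continuous fun x => (1 / 2) * (B |s - t| x - B (s + t) x) :=
      continuous_const.mul ((hB _).sub (hB _))
    simp_rw [hdec]
    rw [intervalIntegral.integral_add (hA.intervalIntegrable _ _) (hBB.intervalIntegrable _ _),
      intervalIntegral.integral_const_mul,
      intervalIntegral.integral_sub ((hB _).intervalIntegrable _ _)
        ((hB _).intervalIntegrable _ _)]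
  have hAb : |∫ x in (0 : ℝ)..N, A x| ≤ Real.pi := by
    have : |∫ x in (0 : ℝ)..N, A x| ≤ ∫ x in (0 : ℝ)..N, 2 * (1 / (1 + x ^ 2)) := by
      rw [← Real.norm_eq_abs]
      refine intervalIntegral.norm_integral_le_of_norm_le hN (ae_of_all _ fun x _ => ?_) ?_
      · rw [mul_one_div, le_div_iff₀ (by positivity)]
        have := abs_dirichletSine_mul_sineWeight_le h1 hs' ht' x
        have e : |dirichletSine s x * dirichletSine t x * sineWeight ε x|
            = ‖A x‖ * (1 + x ^ 2) := by
          simp only [A, sineWeight, Real.norm_eq_abs]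
          rw [abs_mul, abs_mul (_ * _), abs_mul (1 + x ^ 2), abs_of_nonneg (by positivity : 0 ≤ 1 + x ^ 2)]
          ring
        linarith
      · exact (continuous_const.mul (continuous_const.div (by fun_prop)
          fun x => by positivity)).intervalIntegrable _ _
    refine this.trans ?_
    rw [intervalIntegral.integral_const_mul, integral_one_div_one_add_sq, Real.arctan_zero, sub_zero]
    linarith [Real.arctan_lt_pi_div_two N]
  have hd : 0 < |s - t| := abs_pos.mpr (sub_ne_zero.mpr hst)
  have hle : |s - t| ≤ s + t := abs_le.mpr ⟨by linarith [hs.1, ht.1], by linarith [hs.1, ht.1]⟩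
  have hB1 := abs_integral_cos_mul_rpow_le h0 h1 hd hN
  have hB2 := abs_integral_cos_mul_rpow_le h0 h1 (hd.trans_le hle) hN
  have hmono : (s + t) ^ (-ε) ≤ |s - t| ^ (-ε) :=
    Real.rpow_le_rpow_of_nonpos hd hle (by linarith)
  -- Since `|s - t| ≤ 1`, the bounded contribution `π` is absorbed into a multiple of `|s -
  -- t|^(-ε)`.
  have hone : 1 ≤ |s - t| ^ (-ε) :=
    Real.one_le_rpow_of_pos_of_le_one_of_nonpos hd
      (abs_le.mpr ⟨by linarith [hs.1, ht.2], by linarith [hs.2, ht.1]⟩) (by linarith)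
  have hB2' := hB2.trans (mul_le_mul_of_nonneg_left hmono (by positivity))
  have hpi : Real.pi ≤ Real.pi * |s - t| ^ (-ε) := le_mul_of_one_le_right Real.pi_pos.le hone
  rw [heven, hint]
  simp only [abs_le] at hAb hB1 hB2' ⊢
  simp only [B]
  constructor <;> linarith [hAb.1, hAb.2, hB1.1, hB1.2, hB2'.1, hB2'.2]

/-- On the unit square the integrand agrees with that of the convolution of two integrable
functions: the indicator of `(0, 1]`, and `|u|^c` cut off to `[-1, 1]`. -/
lemma integrable_abs_sub_rpow_prod {c : ℝ} (hc : -1 < c) :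
    Integrable (fun q : ℝ × ℝ => |q.1 - q.2| ^ c)
      ((volume.restrict (Ioc (0 : ℝ) 1)).prod (volume.restrict (Ioc (0 : ℝ) 1))) := by
  have h1 : IntegrableOn (fun u : ℝ => |u| ^ c) (Icc (-1 : ℝ) 1) := by
    have hp : IntervalIntegrable (fun u : ℝ => |u| ^ c) volume 0 1 := by
      refine (intervalIntegral.intervalIntegrable_rpow' (a := 0) (b := 1) hc).congr_ae ?_
      refine (ae_restrict_mem measurableSet_uIoc).mono fun x hx => ?_
      rw [uIoc_of_le zero_le_one] at hx
      simp only [abs_of_pos hx.1]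
    have hn : IntervalIntegrable (fun u : ℝ => |u| ^ c) volume (-1) 0 := by
      have := (IntervalIntegrable.iff_comp_neg (f := fun u : ℝ => |u| ^ c)).mp hp
      simp only [abs_neg, neg_zero] at this
      exact this.symm
    rw [integrableOn_Icc_iff_integrableOn_Ioc,
      ← intervalIntegrable_iff_integrableOn_Ioc_of_le (by norm_num)]
    exact hn.trans hp
  have h2 : Integrable ((Icc (-1 : ℝ) 1).indicator fun u : ℝ => |u| ^ c) :=
    h1.integrable_indicator measurableSet_Icc
  have h3 : Integrable ((Ioc (0 : ℝ) 1).indicator fun _ : ℝ => (1 : ℝ)) :=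
    (integrable_indicator_iff measurableSet_Ioc).mpr (by simp [IntegrableOn])
  have h4 := h3.convolution_integrand (ContinuousLinearMap.mul ℝ ℝ) h2
  rw [Measure.prod_restrict]
  refine (h4.integrableOn (s := Ioc 0 1 ×ˢ Ioc 0 1)).congr_fun (fun q hq => ?_)
    (measurableSet_Ioc.prod measurableSet_Ioc)
  obtain ⟨⟨ha, hb⟩, ⟨hc, hd⟩⟩ := hq
  have h5 : q.1 - q.2 ∈ Icc (-1 : ℝ) 1 := ⟨by linarith, by linarith⟩
  have h6 : q.2 ∈ Ioc (0 : ℝ) 1 := ⟨hc, hd⟩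
  simp [h5, h6]

lemma ae_fst_ne_snd_prod (μ ν : Measure ℝ) [SFinite ν] [NullSingletonClass ν] :
    ∀ᵐ q : ℝ × ℝ ∂μ.prod ν, q.1 ≠ q.2 := by
  have hm : MeasurableSet {q : ℝ × ℝ | q.1 = q.2} := measurableSet_eq_fun measurable_fst measurable_snd
  have : μ.prod ν {q : ℝ × ℝ | q.1 = q.2} = 0 := by
    rw [Measure.measure_prod_null hm]
    refine ae_of_all _ fun x => ?_
    have : Prod.mk x ⁻¹' {q : ℝ × ℝ | q.1 = q.2} = {x} := by ext y; simp [eq_comm]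
    beta_reduce
    rw [this]; simp
  rw [ae_iff]; simpa using this

/-! ### Integrability of the transform of the cube tent -/

section cube

variable {d : ℕ}

/-- The Fourier transform of `x ↦ (1 - max |x_j|)_+`, up to normalization. -/
noncomputable def cubeTransform (ξ : Fin d → ℝ) : ℝ :=
  ∫ s in (0 : ℝ)..1, ∏ j, dirichletSine s (ξ j)

lemma continuous_cubeTransform : Continuous (cubeTransform (d := d)) := by
  refine intervalIntegral.continuous_parametric_intervalIntegral_of_continuous' ?_ 0 1
  refine continuous_finsetProd _ fun j _ => ?_
  exact continuous_dirichletSine.comp (by fun_prop : Continuous fun q : (Fin d → ℝ) × ℝ => (q.2, q.1 j))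

/-- The square is a double integral over `(s, t)`. Fubini turns the integral over the box into the
`d`-th power of a one-dimensional integral of size `|s - t|^(-ε)`, and `|s - t|^(-εd)` is integrable
because `εd < 1`. Truncating to a box makes Fubini available; the bound does not depend on `N`. -/
lemma integral_box_cubeTransform_sq_le {ε : ℝ} (h0 : 0 < ε) (h1 : ε < 1) (hd : ε * d < 1) :
    ∃ C : ℝ, ∀ N : ℝ, 0 ≤ N → ∫ ξ in Set.pi univ fun _ : Fin d => Ioc (-N) N,
      cubeTransform ξ ^ 2 * ∏ j, sineWeight ε (ξ j) ≤ C := by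
  set ν := volume.restrict (Ioc (0 : ℝ) 1)
  set A : ℝ := 2 * Real.pi + 2 * (1 / ε + 2)
  have hint := integrable_abs_sub_rpow_prod (c := -(ε * d)) (by linarith)
  refine ⟨∫ q, A ^ d * |q.1 - q.2| ^ (-(ε * d)) ∂ν.prod ν, fun N hN => ?_⟩
  set S := Set.pi univ fun _ : Fin d => Ioc (-N) N
  set K : (Fin d → ℝ) → ℝ × ℝ → ℝ := fun ξ q =>
    ∏ j, (dirichletSine q.1 (ξ j) * dirichletSine q.2 (ξ j) * sineWeight ε (ξ j))
  have hKc : Continuous (Function.uncurry K) := by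
    refine continuous_finsetProd _ fun j _ => ?_
    exact ((continuous_dirichletSine.comp
      (by fun_prop : Continuous fun q : (Fin d → ℝ) × (ℝ × ℝ) => (q.2.1, q.1 j))).mul
      (continuous_dirichletSine.comp
      (by fun_prop : Continuous fun q : (Fin d → ℝ) × (ℝ × ℝ) => (q.2.2, q.1 j)))).mul
      ((continuous_sineWeight ε).comp
      (by fun_prop : Continuous fun q : (Fin d → ℝ) × (ℝ × ℝ) => q.1 j))
  have hmem : ∀ᵐ q ∂ν.prod ν, q ∈ Ioc (0 : ℝ) 1 ×ˢ Ioc (0 : ℝ) 1 := by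
    rw [Measure.prod_restrict]
    exact ae_restrict_mem (measurableSet_Ioc.prod measurableSet_Ioc)
  have hSfin : IsFiniteMeasure (volume.restrict S) := by
    refine ⟨?_⟩
    rw [Measure.restrict_apply_univ, Real.volume_pi_Ioc]
    exact ENNReal.prod_lt_top fun _ _ => ENNReal.ofReal_lt_top
  have hKi : Integrable (Function.uncurry K) ((volume.restrict S).prod (ν.prod ν)) := by
    refine Integrable.of_bound hKc.aestronglyMeasurable (2 ^ d) ?_
    filter_upwards [Measure.quasiMeasurePreserving_snd.ae hmem] with q hq
    obtain ⟨⟨ha, hb⟩, ⟨hc, hd⟩⟩ := hq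
    simp only [Function.uncurry, K, norm_prod]
    refine (Finset.prod_le_prod (fun j _ => norm_nonneg _) (g := fun _ => (2 : ℝ))
      fun j _ => ?_).trans (by simp)
    exact abs_dirichletSine_mul_sineWeight_le h1 (abs_le.mpr ⟨by linarith, hb⟩)
      (abs_le.mpr ⟨by linarith, hd⟩) _
  have hsq : ∀ ξ : Fin d → ℝ, cubeTransform ξ ^ 2 * ∏ j, sineWeight ε (ξ j)
      = ∫ q, K ξ q ∂ν.prod ν := by
    intro ξ
    simp only [K, Finset.prod_mul_distrib]
    rw [integral_mul_const, integral_prod_mul (fun s => ∏ j, dirichletSine s (ξ j))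
      (fun s => ∏ j, dirichletSine s (ξ j)), cubeTransform,
      intervalIntegral.integral_of_le zero_le_one, sq]
  simp_rw [hsq]
  rw [integral_integral_swap hKi]
  refine (le_abs_self _).trans ?_
  rw [← Real.norm_eq_abs]
  refine norm_integral_le_of_norm_le (hint.const_mul _) ?_
  filter_upwards [hmem, ae_fst_ne_snd_prod ν ν] with q hq hne
  have hpi : ∫ ξ in S, K ξ q = ∏ _j : Fin d,
      ∫ x in (-N)..N, dirichletSine q.1 x * dirichletSine q.2 x * sineWeight ε x := by
    rw [volume_pi, Measure.restrict_pi_pi]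
    simp only [K]
    rw [integral_fintype_prod_eq_prod (fun (_ : Fin d) x =>
      dirichletSine q.1 x * dirichletSine q.2 x * sineWeight ε x)]
    simp_rw [intervalIntegral.integral_of_le (by linarith : -N ≤ N)]
  rw [hpi, Finset.prod_const, Finset.card_univ, Fintype.card_fin, norm_pow, ← neg_mul,
    Real.rpow_mul (abs_nonneg _), Real.rpow_natCast, ← mul_pow]
  refine pow_le_pow_left₀ (norm_nonneg _) ?_ _
  exact abs_integral_dirichletSine_mul_le h0 h1 (Ioc_subset_Icc_self hq.1)
    (Ioc_subset_Icc_self hq.2) hne hN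

lemma integrable_cubeTransform (hd : 1 ≤ d) : Integrable (cubeTransform (d := d)) := by
  have hd' : (1 : ℝ) ≤ d := by exact_mod_cast hd
  -- Any `ε` in `(0, 1)` with `εd < 1` would do; this one gives `εd = 1/2`.
  set ε : ℝ := 1 / (2 * d)
  have h0 : 0 < ε := by positivity
  have h1 : ε < 1 := by
    rw [div_lt_one (by positivity)]; linarith
  have h2 : ε * d < 1 := by
    simp only [ε]; field_simp; norm_num
  obtain ⟨C, hC⟩ := integral_box_cubeTransform_sq_le h0 h1 h2
  set Q : (Fin d → ℝ) → ℝ := fun ξ => cubeTransform ξ ^ 2 * ∏ j, sineWeight ε (ξ j)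
  have hW : Continuous fun ξ : Fin d → ℝ => ∏ j, sineWeight ε (ξ j) :=
    continuous_finsetProd _ fun j _ => (continuous_sineWeight ε).comp (continuous_apply j)
  have hWpos : ∀ ξ : Fin d → ℝ, 0 < ∏ j, sineWeight ε (ξ j) :=
    fun ξ => Finset.prod_pos fun j _ => sineWeight_pos ε _
  have hQc : Continuous Q := (continuous_cubeTransform.pow 2).mul hW
  have hQ0 : ∀ ξ, 0 ≤ Q ξ := fun ξ => mul_nonneg (sq_nonneg _) (hWpos ξ).le
  have hcov : AECover volume atTop fun n : ℕ => Set.pi univ fun _ : Fin d => Ioc (-(n : ℝ)) n := by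
    refine ⟨ae_of_all _ fun ξ => ?_, fun n => MeasurableSet.univ_pi fun _ => measurableSet_Ioc⟩
    have : ∀ j, ∀ᶠ n : ℕ in atTop, ξ j ∈ Ioc (-(n : ℝ)) n := fun j => by
      obtain ⟨m, hm⟩ := exists_nat_gt |ξ j|
      filter_upwards [eventually_ge_atTop m] with n hn
      have : (m : ℝ) ≤ n := by exact_mod_cast hn
      have h := abs_lt.mp (hm.trans_le this)
      exact ⟨h.1, h.2.le⟩
    filter_upwards [eventually_all.mpr this] with n hn
    exact fun j _ => hn j
  have hQi : Integrable Q := by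
    refine hcov.integrable_of_integral_norm_bounded C (fun n => ?_) (Eventually.of_forall fun n => ?_)
    · refine (hQc.locallyIntegrable.integrableOn_isCompact
        (isCompact_univ_pi fun _ : Fin d => isCompact_Icc (a := -(n : ℝ)) (b := n))).mono_set ?_
      exact Set.pi_mono fun _ _ => Ioc_subset_Icc_self
    · simp_rw [Real.norm_of_nonneg (hQ0 _)]
      exact hC n (Nat.cast_nonneg n)
  have hWi : Integrable fun ξ : Fin d → ℝ => ∏ j, (sineWeight ε (ξ j))⁻¹ := by
    rw [volume_pi]
    exact Integrable.fintype_prod (f := fun (_ : Fin d) x => (sineWeight ε x)⁻¹)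
      fun _ => integrable_inv_sineWeight h0
  refine (hQi.add hWi).mono' continuous_cubeTransform.aestronglyMeasurable (ae_of_all _ fun ξ => ?_)
  simp only [Pi.add_apply, Finset.prod_inv_distrib, Q, Real.norm_eq_abs]
  set W := ∏ j, sineWeight ε (ξ j)
  have hw : 0 < W := hWpos ξ
  -- Cauchy–Schwarz in pointwise form: `2|T| ≤ T² W + W⁻¹`, and both terms on the right are
  -- integrable.
  have h3 : 0 ≤ W⁻¹ * (|cubeTransform ξ| * W - 1) ^ 2 := by positivity
  have h4 : W⁻¹ * (|cubeTransform ξ| * W - 1) ^ 2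
      = cubeTransform ξ ^ 2 * W - 2 * |cubeTransform ξ| + W⁻¹ := by
    rw [← sq_abs (cubeTransform ξ)]
    field_simp
    ring
  linarith [abs_nonneg (cubeTransform ξ)]

end cube

/-! ### The cube tent as a Fourier transform -/

section coordinates

variable {d : ℕ}

lemma integral_euclidean_prod (f : Fin d → ℝ → ℂ) :
    ∫ v : EuclideanSpace ℝ (Fin d), ∏ j, f j (v j) = ∏ j, ∫ x, f j x := by
  rw [← integral_fintype_prod_volume_eq_prod]
  exact (EuclideanSpace.volume_preserving_symm_measurableEquiv_toLp (Fin d)).integral_comp'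
    (fun x : Fin d → ℝ => ∏ j, f j (x j))

lemma integrable_euclidean_prod {f : Fin d → ℝ → ℂ} (hf : ∀ j, Integrable (f j)) :
    Integrable fun v : EuclideanSpace ℝ (Fin d) => ∏ j, f j (v j) :=
  (EuclideanSpace.volume_preserving_symm_measurableEquiv_toLp (Fin d)).integrable_comp_of_integrable
    (g := fun x : Fin d → ℝ => ∏ j, f j (x j)) (Integrable.fintype_prod hf)

lemma iSup_abs_eq_norm (x : EuclideanSpace ℝ (Fin d)) : ⨆ j, |x j| = ‖WithLp.ofLp x‖ := by
  apply le_antisymm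
  · exact Real.iSup_le (fun j => norm_le_pi_norm (WithLp.ofLp x) j) (norm_nonneg _)
  · refine (pi_norm_le_iff_of_nonneg (Real.iSup_nonneg fun j => abs_nonneg _)).mpr fun j => ?_
    exact le_ciSup (f := fun j => |x j|) (Set.finite_range _).bddAbove j

lemma integral_indicator_mul_exp (s η : ℝ) (hs : 0 < s) :
    ∫ x : ℝ, (if |x| < s then 1 else 0) * Complex.exp (↑(-2 * Real.pi * (x * η)) * Complex.I)
      = 2 * dirichletSine s (2 * Real.pi * η) := by
  have h1 : ∀ x : ℝ, (if |x| < s then (1 : ℂ) else 0) *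
      Complex.exp (↑(-2 * Real.pi * (x * η)) * Complex.I) = (Ioo (-s) s).indicator
        (fun x : ℝ => Complex.exp (↑(-(2 * Real.pi * η) * x) * Complex.I)) x := by
    intro x
    have : |x| < s ↔ x ∈ Ioo (-s) s := abs_lt
    by_cases h : x ∈ Ioo (-s) s
    · rw [if_pos (this.mpr h), indicator_of_mem h, one_mul]
      congr 3; ring
    · rw [if_neg (this.not.mpr h), indicator_of_notMem h, zero_mul]
  simp_rw [h1]
  rw [integral_indicator measurableSet_Ioo, ← integral_Ioc_eq_integral_Ioo,
    ← intervalIntegral.integral_of_le (by linarith)]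
  unfold dirichletSine
  set c := 2 * Real.pi * η
  by_cases hc : c = 0
  · simp [hc]; ring
  · rw [intervalIntegral.integral_comp_mul_left (fun t : ℝ => Complex.exp (t * Complex.I))
      (neg_ne_zero.mpr hc)]
    have := Complex.ofReal_ne_zero.mpr hc
    rw [show -c * -s = -(-c * s) by ring, integral_exp_mul_I_eq_sinc, neg_mul, Real.sinc_neg,
      Complex.real_smul, mul_comm c s]
    push_cast
    field_simp

/-- The tent `(1 - max |x_j|)_+`. -/
noncomputable def cubeTent (x : EuclideanSpace ℝ (Fin d)) : ℝ := max 0 (1 - ⨆ j, |x j|)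

lemma continuous_cubeTent : Continuous (cubeTent (d := d)) := by
  unfold cubeTent
  simp_rw [iSup_abs_eq_norm]
  fun_prop

/-- Layer-cake formula: the tent is the length of the set of `s ∈ (0, 1]` with `max |x_j| < s`, so
it averages indicators of cubes, which factor over coordinates. -/
lemma cubeTent_eq_integral (x : EuclideanSpace ℝ (Fin d)) :
    (cubeTent x : ℂ) = ∫ s in Ioc (0 : ℝ) 1, ∏ j, if |x j| < s then (1 : ℂ) else 0 := by
  have h : ∀ s ∈ Ioc (0 : ℝ) 1, (∏ j, if |x j| < s then (1 : ℂ) else 0)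
      = (Ioi ‖WithLp.ofLp x‖).indicator (fun _ => (1 : ℂ)) s := by
    intro s hs
    rw [Finset.prod_boole]
    have : (∀ j ∈ Finset.univ, |x j| < s) ↔ s ∈ Ioi ‖WithLp.ofLp x‖ := by
      rw [mem_Ioi, pi_norm_lt_iff hs.1]; simp
    simp only [this, indicator_apply]
  rw [setIntegral_congr_fun measurableSet_Ioc h, setIntegral_indicator measurableSet_Ioi,
    Ioc_inter_Ioi, max_eq_right (norm_nonneg _)]
  simp only [integral_const, MeasurableSet.univ, measureReal_restrict_apply, univ_inter,
    Real.volume_real_Ioc, cubeTent, iSup_abs_eq_norm]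
  rw [max_comm]
  simp

/-- Transforming the layers one by one gives, up to the factor `2^d` and a dilation by `2π`, the
integrable function `cubeTransform`; Fourier inversion then applies. -/
lemma isWiener_cubeTent (hd : 1 ≤ d) :
    IsWiener fun x : EuclideanSpace ℝ (Fin d) => (cubeTent x : ℂ) := by
  set ν := volume.restrict (Ioc (0 : ℝ) 1)
  have hmem : ∀ᵐ s ∂ν, s ∈ Ioc (0 : ℝ) 1 := ae_restrict_mem measurableSet_Ioc
  set J : EuclideanSpace ℝ (Fin d) → EuclideanSpace ℝ (Fin d) → ℝ → ℂ := fun ξ v s =>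
    ∏ j, ((if |v j| < s then 1 else 0) *
      Complex.exp (↑(-2 * Real.pi * (v j * ξ j)) * Complex.I))
  have hJi : ∀ ξ, Integrable (Function.uncurry (J ξ)) (volume.prod ν) := by
    intro ξ
    have hB : Integrable fun v : EuclideanSpace ℝ (Fin d) =>
        ∏ j, (Icc (-1 : ℝ) 1).indicator (fun _ => (1 : ℂ)) (v j) :=
      integrable_euclidean_prod fun _ => (integrable_indicator_iff measurableSet_Icc).mpr
        (by simp [IntegrableOn])
    refine (hB.norm.comp_fst ν).mono' ?_ ?_
    · refine Measurable.aestronglyMeasurable (Finset.measurable_prod _ fun j _ => ?_)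
      refine Measurable.mul (Measurable.ite (measurableSet_lt ?_ measurable_snd)
        measurable_const measurable_const) (Continuous.measurable (by fun_prop))
      exact Continuous.measurable (by fun_prop)
    · filter_upwards [Measure.quasiMeasurePreserving_snd.ae hmem] with q hq
      simp only [Function.uncurry, J, norm_prod]
      refine Finset.prod_le_prod (fun _ _ => norm_nonneg _) fun j _ => ?_
      rw [norm_mul, Complex.norm_exp_ofReal_mul_I, mul_one]
      by_cases h : |q.1 j| < q.2
      · have h2 := abs_le.mp (h.le.trans hq.2)
        rw [indicator_of_mem (show q.1 j ∈ Icc (-1 : ℝ) 1 from h2)]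
        simp [h]
      · simp [h]
  have hT : Integrable fun x : EuclideanSpace ℝ (Fin d) => (cubeTent x : ℂ) := by
    refine (hJi 0).integral_prod_left.congr (ae_of_all _ fun x => ?_)
    simp [J, cubeTent_eq_integral, ν]
  refine isWiener_of_integrable_fourier (Complex.continuous_ofReal.comp continuous_cubeTent) hT ?_
  have hF : ∀ ξ : EuclideanSpace ℝ (Fin d),
      FourierTransform.fourier (fun x : EuclideanSpace ℝ (Fin d) => (cubeTent x : ℂ)) ξ
        = 2 ^ d * (cubeTransform fun j => 2 * Real.pi * ξ j : ℝ) := by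
    intro ξ
    rw [Real.fourier_eq']
    have h1 : ∀ v : EuclideanSpace ℝ (Fin d),
        Complex.exp (↑(-2 * Real.pi * inner ℝ v ξ) * Complex.I) • (cubeTent v : ℂ)
          = ∫ s, J ξ v s ∂ν := by
      intro v
      rw [cubeTent_eq_integral, smul_eq_mul, ← integral_const_mul]
      refine integral_congr_ae (ae_of_all _ fun s => ?_)
      simp only [J, Finset.prod_mul_distrib]
      rw [mul_comm, ← Complex.exp_sum]
      congr 2
      rw [← Finset.sum_mul]
      congr 1
      simp only [PiLp.inner_apply, RCLike.inner_apply, conj_trivial, Finset.mul_sum]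
      push_cast
      exact Finset.sum_congr rfl fun j _ => by ring
    simp_rw [h1]
    rw [integral_integral_swap (hJi ξ), cubeTransform, intervalIntegral.integral_of_le zero_le_one,
      ← integral_complex_ofReal, ← integral_const_mul]
    refine integral_congr_ae ?_
    filter_upwards [hmem] with s hs
    simp only [J]
    rw [integral_euclidean_prod (fun j x => (if |x| < s then 1 else 0) *
      Complex.exp (↑(-2 * Real.pi * (x * ξ j)) * Complex.I))]
    simp_rw [integral_indicator_mul_exp s _ hs.1]
    rw [Finset.prod_mul_distrib]
    simp
  have h2 : Integrable fun ξ : EuclideanSpace ℝ (Fin d) => cubeTransform fun j => ξ j :=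
    (EuclideanSpace.volume_preserving_symm_measurableEquiv_toLp (Fin d)).integrable_comp_of_integrable
      (integrable_cubeTransform hd)
  have h3 := (h2.comp_smul (R := 2 * Real.pi) (by positivity)).ofReal (𝕜 := ℂ) |>.const_mul (2 ^ d)
  refine h3.congr (ae_of_all _ fun ξ => ?_)
  rw [hF]
  rfl

lemma isWiener_tent : IsWiener fun x : ℝ => ((max 0 (1 - |x|) : ℝ) : ℂ) := by
  obtain ⟨g, hg, h⟩ := isWiener_cubeTent (d := 1) le_rfl
  set e : ℝ ≃ᵐ EuclideanSpace ℝ (Fin 1) :=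
    (MeasurableEquiv.funUnique (Fin 1) ℝ).symm.trans (MeasurableEquiv.toLp 2 (Fin 1 → ℝ))
  have he : MeasurePreserving e volume volume :=
    ((EuclideanSpace.volume_preserving_symm_measurableEquiv_toLp (Fin 1)).symm).comp
      (volume_preserving_funUnique (Fin 1) ℝ).symm
  have hev : ∀ x j, e x j = x := fun x j => rfl
  refine ⟨g ∘ e, he.integrable_comp_of_integrable hg, fun x => ?_⟩
  have hx := h (e x)
  rw [← he.integral_comp'] at hx
  simp only [cubeTent, hev, ciSup_const] at hx
  refine hx.trans (integral_congr_ae (ae_of_all _ fun y => ?_))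
  simp [wienerChar, PiLp.inner_apply, hev]

end coordinates

/-! ### Taylor's formula at infinity and truncated powers -/

section taylor

variable {F : ℕ → ℝ → ℂ} {n : ℕ}

/-- Taylor's formula with integral remainder, expanded at infinity. -/
lemma eq_integral_Ioi_of_hasDerivAt (hd : ∀ k < n, ∀ v > 0, HasDerivAt (F k) (F (k + 1) v) v)
    (hc : ContinuousWithinAt (F 0) (Ici 0) 0)
    (h0 : ∀ k, 1 ≤ k → k < n → Tendsto (fun v : ℝ => (v : ℂ) ^ k * F k v) (𝓝[>] 0) (𝓝 0))
    (hinf : ∀ k < n, Tendsto (fun v : ℝ => (v : ℂ) ^ k * F k v) atTop (𝓝 0))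
    (hi : ∀ k < n, IntegrableOn (fun v : ℝ => (v : ℂ) ^ k * F (k + 1) v) (Ioi 0))
    {u : ℝ} (hu : 0 ≤ u) (m : ℕ) (hm : m < n) :
    F 0 u = (-1) ^ (m + 1) / (m.factorial : ℂ) *
      ∫ v in Ioi u, ((v - u : ℝ) : ℂ) ^ m * F (m + 1) v := by
  have hi' : ∀ k < n, IntegrableOn (fun v : ℝ => ((v - u : ℝ) : ℂ) ^ k * F (k + 1) v) (Ioi u) := by
    intro k hk
    -- On `(u, ∞)` the ratio `(v - u) / v` lies in `[0, 1]`, which transfers integrability from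
    -- expansion point `0` to `u`.
    have h1 : IntegrableOn (fun v : ℝ => (((v - u) / v : ℝ) : ℂ) ^ k *
        ((v : ℂ) ^ k * F (k + 1) v)) (Ioi u) := by
      refine ((hi k hk).mono_set (Ioi_subset_Ioi hu)).bdd_mul (c := 1) ?_ ?_
      · exact (Measurable.pow_const (Complex.measurable_ofReal.comp (by fun_prop)) _).aestronglyMeasurable
      · filter_upwards [ae_restrict_mem measurableSet_Ioi] with v hv
        have hv' : u < v := hv
        rw [norm_pow, Complex.norm_real, Real.norm_of_nonneg (div_nonneg (by linarith) (by linarith))]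
        exact pow_le_one₀ (div_nonneg (by linarith) (by linarith))
          ((div_le_one (by linarith)).mpr (by linarith))
    refine h1.congr_fun (fun v hv => ?_) measurableSet_Ioi
    have hv' : (v : ℂ) ≠ 0 := by
      have : u < v := hv
      exact_mod_cast (by linarith : 0 < v).ne'
    simp only [← mul_assoc, ← mul_pow]
    congr 2
    push_cast
    field_simp
  induction m with
  | zero =>
    have h1 := integral_Ioi_of_hasDerivAt_of_tendsto (a := u) (f := F 0) (f' := F 1) (m := 0) ?_
      (fun v hv => hd 0 hm v (hu.trans_lt hv)) ?_ ?_
    · simp [h1]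
    · rcases hu.eq_or_lt with rfl | hu
      · exact hc
      · exact (hd 0 hm u hu).continuousAt.continuousWithinAt
    · simpa using hi' 0 hm
    · simpa using hinf 0 hm
  | succ m ih =>
    rw [ih (by omega)]
    have h1 := integral_Ioi_mul_deriv_eq_deriv_mul (a := u) (a' := 0) (b' := 0)
      (u := fun v : ℝ => ((v - u : ℝ) : ℂ) ^ (m + 1))
      (u' := fun v : ℝ => (m + 1 : ℂ) * ((v - u : ℝ) : ℂ) ^ m)
      (v := F (m + 1)) (v' := F (m + 1 + 1)) (fun v _ => ?_)
      (fun v hv => hd (m + 1) hm v (hu.trans_lt hv)) (hi' (m + 1) hm) ?_ ?_ ?_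
    · rw [h1]
      simp_rw [mul_assoc (m + 1 : ℂ)]
      rw [integral_const_mul, Nat.factorial_succ]
      have : (m.factorial : ℂ) ≠ 0 := by exact_mod_cast m.factorial_ne_zero
      have h2 : (m : ℂ) + 1 ≠ 0 := by exact_mod_cast m.succ_ne_zero
      push_cast
      field_simp
      ring
    · have h2 : HasDerivAt (fun v : ℝ => ((v - u : ℝ) : ℂ)) 1 v := by
        simpa using ((hasDerivAt_id v).sub_const u).ofReal_comp
      have h3 : HasDerivAt (fun v : ℝ => ((v - u : ℝ) : ℂ) ^ (m + 1)) _ v := h2.pow (m + 1)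
      exact h3.congr_deriv (by simp)
    · have := (hi' m (by omega)).const_mul (m + 1 : ℂ)
      refine this.congr (ae_of_all _ fun v => ?_)
      simp [mul_assoc]
    -- The boundary term at `u` vanishes by continuity when `u > 0`; at `u = 0` the derivative may
    -- be singular and `h0` is needed.
    · rcases hu.eq_or_lt with rfl | hu
      · exact (h0 (m + 1) (by omega) hm).congr fun v => by simp
      · have h2 : ContinuousAt ((fun v : ℝ => ((v - u : ℝ) : ℂ) ^ (m + 1)) * F (m + 1)) u :=
          ContinuousAt.mul (by fun_prop) (hd (m + 1) hm u hu).continuousAt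
        have h3 := h2.tendsto
        simp only [Pi.mul_apply, sub_self, Complex.ofReal_zero] at h3
        rw [zero_pow (by omega), zero_mul] at h3
        exact h3.mono_left nhdsWithin_le_nhds
    · refine squeeze_zero_norm' ?_ (tendsto_zero_iff_norm_tendsto_zero.mp (hinf (m + 1) hm))
      filter_upwards [eventually_gt_atTop u] with v hv
      simp only [Pi.mul_apply, norm_mul, norm_pow, Complex.norm_real]
      rw [Real.norm_of_nonneg (by linarith), Real.norm_of_nonneg (by linarith)]
      gcongr
      linarith

/-- A function on the half-line as a superposition of truncated powers. -/
lemma eq_integral_truncated_pow (hd : ∀ k < n, ∀ v > 0, HasDerivAt (F k) (F (k + 1) v) v)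
    (hc : ContinuousWithinAt (F 0) (Ici 0) 0)
    (h0 : ∀ k, 1 ≤ k → k < n → Tendsto (fun v : ℝ => (v : ℂ) ^ k * F k v) (𝓝[>] 0) (𝓝 0))
    (hinf : ∀ k < n, Tendsto (fun v : ℝ => (v : ℂ) ^ k * F k v) atTop (𝓝 0))
    (hi : ∀ k < n, IntegrableOn (fun v : ℝ => (v : ℂ) ^ k * F (k + 1) v) (Ioi 0))
    {u : ℝ} (hu : 0 ≤ u) {m : ℕ} (hm0 : m ≠ 0) (hm : m < n) :
    F 0 u = ∫ v in Ioi (0 : ℝ), (-1) ^ (m + 1) / (m.factorial : ℂ) * ((v : ℂ) ^ m * F (m + 1) v) *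
      ((max 0 (1 - u / v) : ℝ) : ℂ) ^ m := by
  rw [eq_integral_Ioi_of_hasDerivAt hd hc h0 hinf hi hu m hm, ← integral_const_mul]
  rw [setIntegral_eq_of_subset_of_forall_sdiff_eq_zero (t := Ioi (0 : ℝ)) measurableSet_Ioi
    (Ioi_subset_Ioi hu)]
  · refine setIntegral_congr_fun measurableSet_Ioi fun v hv => ?_
    have hv' : u < v := hv
    have hv0 : 0 < v := hu.trans_lt hv'
    have hvc : (v : ℂ) ≠ 0 := by exact_mod_cast hv0.ne'
    have h1 : u / v ≤ 1 := (div_le_one hv0).mpr hv'.le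
    rw [max_eq_right (by linarith), show ((v - u : ℝ) : ℂ) = v * ((1 - u / v : ℝ) : ℂ) by
      push_cast; field_simp]
    ring
  · intro v hv
    have hv0 : 0 < v := hv.1
    have hv' : v ≤ u := not_lt.mp hv.2
    have h1 : 1 ≤ u / v := (one_le_div hv0).mpr hv'
    rw [max_eq_left (by linarith)]
    simp [hm0]

end taylor

/-! ### Derivatives and bounds of the power profile -/

/-- The profile `t^γ (1 + t^α)^(-β)`. -/
noncomputable def powerProfile (α γ β t : ℝ) : ℝ := t ^ γ * (1 + t ^ α) ^ (-β)

/-- The iterated derivatives of `powerProfile α γ β` on the positive half-line. -/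
noncomputable def powerProfileDeriv (α : ℝ) : ℕ → ℝ → ℝ → ℝ → ℝ
  | 0, γ, β, t => powerProfile α γ β t
  | k + 1, γ, β, t => γ * powerProfileDeriv α k (γ - 1) β t
      - α * β * powerProfileDeriv α k (γ + α - 1) (β + 1) t

lemma hasDerivAt_powerProfile {α γ β t : ℝ} (ht : 0 < t) :
    HasDerivAt (powerProfile α γ β) (γ * powerProfile α (γ - 1) β t
      - α * β * powerProfile α (γ + α - 1) (β + 1) t) t := by
  have hp : 0 < 1 + t ^ α := by positivity
  have h1 := Real.hasDerivAt_rpow_const (p := γ) (Or.inl ht.ne')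
  have h2 := ((Real.hasDerivAt_rpow_const (p := α) (Or.inl ht.ne')).const_add 1).rpow_const
    (p := -β) (Or.inl hp.ne')
  have h3 : HasDerivAt (fun t : ℝ => t ^ γ * (1 + t ^ α) ^ (-β)) _ t := h1.mul h2
  refine h3.congr_deriv ?_
  have e : t ^ (γ + α - 1) = t ^ γ * t ^ (α - 1) := by
    rw [← Real.rpow_add ht]; congr 1; ring
  simp only [powerProfile, e, neg_add]
  ring_nf

lemma hasDerivAt_powerProfileDeriv {α t : ℝ} (ht : 0 < t) (k : ℕ) (γ β : ℝ) :
    HasDerivAt (powerProfileDeriv α k γ β) (powerProfileDeriv α (k + 1) γ β t) t := by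
  induction k generalizing γ β with
  | zero => exact hasDerivAt_powerProfile ht
  | succ k ih => exact ((ih (γ - 1) β).const_mul γ).sub ((ih (γ + α - 1) (β + 1)).const_mul (α * β))

lemma powerProfile_nonneg {α γ β t : ℝ} (ht : 0 ≤ t) : 0 ≤ powerProfile α γ β t := by
  unfold powerProfile; positivity

lemma powerProfile_add_le {α γ β t : ℝ} (ht : 0 < t) :
    powerProfile α (γ + α) (β + 1) t ≤ powerProfile α γ β t := by
  have hp : 0 < 1 + t ^ α := by positivity
  unfold powerProfile
  rw [Real.rpow_add ht, neg_add, Real.rpow_add hp, Real.rpow_neg_one]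
  calc t ^ γ * t ^ α * ((1 + t ^ α) ^ (-β) * (1 + t ^ α)⁻¹)
      = t ^ γ * (1 + t ^ α) ^ (-β) * (t ^ α / (1 + t ^ α)) := by rw [div_eq_mul_inv]; ring
    _ ≤ t ^ γ * (1 + t ^ α) ^ (-β) * 1 := by
        gcongr
        rw [div_le_one hp]; linarith
    _ = _ := mul_one _

lemma pow_mul_powerProfile {α γ β t : ℝ} (ht : 0 < t) (k : ℕ) :
    t ^ k * powerProfile α γ β t = powerProfile α (γ + k) β t := by
  unfold powerProfile
  rw [Real.rpow_add ht, Real.rpow_natCast]; ring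

/-- Each derivative costs a factor `1/t`. The term with exponents `(γ + α - 1, β + 1)` is no worse
than the one with `(γ - 1, β)`, because `t^α / (1 + t^α) ≤ 1`. -/
lemma exists_abs_powerProfileDeriv_le (α : ℝ) (k : ℕ) (γ β : ℝ) : ∃ C : ℝ, 0 ≤ C ∧
    ∀ t > 0, t ^ k * |powerProfileDeriv α k γ β t| ≤ C * powerProfile α γ β t := by
  induction k generalizing γ β with
  | zero =>
    refine ⟨1, zero_le_one, fun t ht => ?_⟩
    simp [powerProfileDeriv, abs_of_nonneg (powerProfile_nonneg ht.le)]
  | succ k ih =>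
    obtain ⟨C₁, h₁, H₁⟩ := ih (γ - 1) β
    obtain ⟨C₂, h₂, H₂⟩ := ih (γ + α - 1) (β + 1)
    refine ⟨|γ| * C₁ + |α * β| * C₂, by positivity, fun t ht => ?_⟩
    have e₁ : t * powerProfile α (γ - 1) β t = powerProfile α γ β t := by
      simpa using pow_mul_powerProfile (α := α) (γ := γ - 1) (β := β) ht 1
    have e₂ : t * powerProfile α (γ + α - 1) (β + 1) t ≤ powerProfile α γ β t := by
      refine le_trans (le_of_eq ?_) (powerProfile_add_le ht)
      simpa using pow_mul_powerProfile (α := α) (γ := γ + α - 1) (β := β + 1) ht 1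
    calc t ^ (k + 1) * |powerProfileDeriv α (k + 1) γ β t|
        ≤ t ^ (k + 1) * (|γ| * |powerProfileDeriv α k (γ - 1) β t|
          + |α * β| * |powerProfileDeriv α k (γ + α - 1) (β + 1) t|) := by
          rw [powerProfileDeriv, ← abs_mul, ← abs_mul]
          gcongr
          exact abs_sub _ _
      _ = |γ| * (t * (t ^ k * |powerProfileDeriv α k (γ - 1) β t|))
          + |α * β| * (t * (t ^ k * |powerProfileDeriv α k (γ + α - 1) (β + 1) t|)) := by ring
      _ ≤ |γ| * (t * (C₁ * powerProfile α (γ - 1) β t))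
          + |α * β| * (t * (C₂ * powerProfile α (γ + α - 1) (β + 1) t)) := by
          refine add_le_add ?_ ?_ <;>
            refine mul_le_mul_of_nonneg_left (mul_le_mul_of_nonneg_left ?_ ht.le) (abs_nonneg _)
          · exact H₁ t ht
          · exact H₂ t ht
      _ = |γ| * C₁ * (t * powerProfile α (γ - 1) β t)
          + |α * β| * C₂ * (t * powerProfile α (γ + α - 1) (β + 1) t) := by ring
      _ ≤ |γ| * C₁ * powerProfile α γ β t + |α * β| * C₂ * powerProfile α γ β t := by
          rw [e₁]; gcongr
      _ = _ := by ring

/-- The general bound suffices for `γ > 0`. For `γ = 0` its majorant does not vanish at `0`, but the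
first derivative is then a multiple of the profile with exponents `(α - 1, β + 1)`, which gives `a =
α`, `b = β + 1`. Hence the restriction to `k ≠ 0`. -/
lemma exists_forall_abs_powerProfileDeriv_le {α γ β : ℝ} (hα : 0 < α) (hγ : 0 ≤ γ)
    (hαβ : γ < α * β) : ∃ a b : ℝ, 0 < a ∧ a < α * b ∧ ∀ k : ℕ, k ≠ 0 → ∃ C : ℝ,
      ∀ t > 0, t ^ k * |powerProfileDeriv α k γ β t| ≤ C * powerProfile α a b t := by
  rcases hγ.eq_or_lt with rfl | hγ
  · refine ⟨α, β + 1, hα, by linarith, fun k hk => ?_⟩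
    obtain ⟨k, rfl⟩ := Nat.exists_eq_succ_of_ne_zero hk
    obtain ⟨C, hC, H⟩ := exists_abs_powerProfileDeriv_le α k (0 + α - 1) (β + 1)
    refine ⟨|α * β| * C, fun t ht => ?_⟩
    have e : t * powerProfile α (0 + α - 1) (β + 1) t = powerProfile α α (β + 1) t := by
      simpa using pow_mul_powerProfile (α := α) (γ := 0 + α - 1) (β := β + 1) ht 1
    calc t ^ (k + 1) * |powerProfileDeriv α (k + 1) 0 β t|
        = |α * β| * (t * (t ^ k * |powerProfileDeriv α k (0 + α - 1) (β + 1) t|)) := by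
          rw [powerProfileDeriv, zero_mul, zero_sub, abs_neg, abs_mul (α * β)]; ring
      _ ≤ |α * β| * (t * (C * powerProfile α (0 + α - 1) (β + 1) t)) := by
          exact mul_le_mul_of_nonneg_left (mul_le_mul_of_nonneg_left (H t ht) ht.le) (abs_nonneg _)
      _ = |α * β| * C * (t * powerProfile α (0 + α - 1) (β + 1) t) := by ring
      _ = _ := by rw [e]
  · refine ⟨γ, β, hγ, hαβ, fun k _ => ?_⟩
    obtain ⟨C, _, H⟩ := exists_abs_powerProfileDeriv_le α k γ β
    exact ⟨C, H⟩

section bounds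

variable {α a b : ℝ}

lemma powerProfile_le_rpow {t : ℝ} (hb : 0 ≤ b) (ht : 0 ≤ t) : powerProfile α a b t ≤ t ^ a := by
  unfold powerProfile
  refine mul_le_of_le_one_right (by positivity) (Real.rpow_le_one_of_one_le_of_nonpos ?_ (by linarith))
  linarith [Real.rpow_nonneg ht α]

lemma powerProfile_le_rpow_sub {t : ℝ} (hb : 0 ≤ b) (ht : 0 < t) :
    powerProfile α a b t ≤ t ^ (a - α * b) := by
  unfold powerProfile
  rw [sub_eq_add_neg, Real.rpow_add ht, ← mul_neg, Real.rpow_mul ht.le]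
  refine mul_le_mul_of_nonneg_left ?_ (by positivity)
  exact Real.rpow_le_rpow_of_nonpos (by positivity) (by linarith) (by linarith)

lemma tendsto_powerProfile_nhdsGT_zero (ha : 0 < a) (hb : 0 ≤ b) :
    Tendsto (powerProfile α a b) (𝓝[>] 0) (𝓝 0) := by
  have h : Tendsto (fun t : ℝ => t ^ a) (𝓝[>] 0) (𝓝 0) := by
    have := (Real.continuousAt_rpow_const 0 a (Or.inr ha.le)).tendsto
    rw [Real.zero_rpow ha.ne'] at this
    exact this.mono_left nhdsWithin_le_nhds
  refine squeeze_zero' ?_ ?_ h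
  · filter_upwards [self_mem_nhdsWithin] with t ht using powerProfile_nonneg (le_of_lt ht)
  · filter_upwards [self_mem_nhdsWithin] with t ht using powerProfile_le_rpow hb (le_of_lt ht)

lemma tendsto_powerProfile_atTop (hab : a < α * b) (hb : 0 ≤ b) :
    Tendsto (powerProfile α a b) atTop (𝓝 0) := by
  have h := tendsto_rpow_neg_atTop (y := α * b - a) (by linarith)
  rw [neg_sub] at h
  refine squeeze_zero' ?_ ?_ h
  · filter_upwards [eventually_gt_atTop 0] with t ht using powerProfile_nonneg (le_of_lt ht)
  · filter_upwards [eventually_gt_atTop 0] with t ht using powerProfile_le_rpow_sub hb ht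

lemma measurable_powerProfile : Measurable (powerProfile α a b) := by
  unfold powerProfile; fun_prop

lemma integrableOn_powerProfile_div (ha : 0 < a) (hab : a < α * b) (hb : 0 ≤ b) :
    IntegrableOn (fun t => powerProfile α a b t / t) (Ioi 0) := by
  have hm : Measurable fun t => powerProfile α a b t / t := measurable_powerProfile.div measurable_id
  rw [← Ioc_union_Ioi_eq_Ioi zero_le_one, integrableOn_union]
  constructor
  · have h := (intervalIntegral.intervalIntegrable_rpow' (a := 0) (b := 1) (r := a - 1) (by linarith))
    rw [intervalIntegrable_iff_integrableOn_Ioc_of_le zero_le_one] at h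
    refine h.mono' hm.aestronglyMeasurable ?_
    filter_upwards [ae_restrict_mem measurableSet_Ioc] with t ht
    rw [Real.norm_of_nonneg (div_nonneg (powerProfile_nonneg ht.1.le) ht.1.le),
      Real.rpow_sub_one ht.1.ne']
    exact div_le_div_of_nonneg_right (powerProfile_le_rpow hb ht.1.le) ht.1.le
  · refine (integrableOn_Ioi_rpow_of_lt (a := a - α * b - 1) (by linarith) one_pos).mono'
      hm.aestronglyMeasurable ?_
    filter_upwards [ae_restrict_mem measurableSet_Ioi] with t ht
    have ht0 : 0 < t := one_pos.trans ht
    rw [Real.norm_of_nonneg (div_nonneg (powerProfile_nonneg ht0.le) ht0.le),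
      Real.rpow_sub_one ht0.ne']
    exact div_le_div_of_nonneg_right (powerProfile_le_rpow_sub hb ht0) ht0.le

end bounds

/-! ### Reduction to one truncated power -/

/-- Membership of `t^γ (1 + t^α)^(-β)` composed with a homogeneous gauge, reduced to that of one
truncated power. -/
lemma isWiener_powerProfile_comp {V : Type*} [NormedAddCommGroup V] [InnerProductSpace ℝ V]
    [MeasurableSpace V] [BorelSpace V] [FiniteDimensional ℝ V] {ρ : V → ℝ} (hρ : ∀ x, 0 ≤ ρ x)
    {q : ℝ} (hhom : ∀ x, ∀ v > 0, ρ ((v ^ q)⁻¹ • x) = ρ x / v) {m : ℕ} (hm : m ≠ 0)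
    (hΦ : IsWiener fun x => ((max 0 (1 - ρ x) : ℝ) : ℂ) ^ m) {α γ β : ℝ} (hα : 0 < α)
    (hγ : 0 ≤ γ) (hαβ : γ < α * β) : IsWiener fun x => (powerProfile α γ β (ρ x) : ℂ) := by
  have hβ : 0 ≤ β := (pos_of_mul_pos_right (hγ.trans_lt hαβ) hα.le).le
  obtain ⟨a, b, ha, hab, H⟩ := exists_forall_abs_powerProfileDeriv_le hα hγ hαβ
  have hb : 0 ≤ b := (pos_of_mul_pos_right (ha.trans hab) hα.le).le
  set F : ℕ → ℝ → ℂ := fun k t => (powerProfileDeriv α k γ β t : ℂ)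
  have hd : ∀ k < m + 1, ∀ v > 0, HasDerivAt (F k) (F (k + 1) v) v :=
    fun k _ v hv => (hasDerivAt_powerProfileDeriv hv k γ β).ofReal_comp
  have hnorm : ∀ (k : ℕ) (v : ℝ), 0 < v →
      ‖(v : ℂ) ^ k * F k v‖ = v ^ k * |powerProfileDeriv α k γ β v| := by
    intro k v hv
    simp [F, abs_of_pos hv]
  have hc : ContinuousWithinAt (F 0) (Ici 0) 0 := by
    refine (Complex.continuous_ofReal.continuousAt.comp ?_).continuousWithinAt
    refine (Real.continuousAt_rpow_const 0 γ (Or.inr hγ)).mul ?_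
    refine (continuousAt_const.add (Real.continuousAt_rpow_const 0 α (Or.inr hα.le))).rpow_const
      (Or.inl ?_)
    simp [Real.zero_rpow hα.ne']
  have h0 : ∀ k, 1 ≤ k → k < m + 1 → Tendsto (fun v : ℝ => (v : ℂ) ^ k * F k v) (𝓝[>] 0) (𝓝 0) := by
    intro k hk _
    obtain ⟨C, hC⟩ := H k (by omega)
    have h1 := (tendsto_powerProfile_nhdsGT_zero (α := α) ha hb).const_mul C
    rw [mul_zero] at h1
    refine squeeze_zero_norm' ?_ h1
    filter_upwards [self_mem_nhdsWithin] with v hv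
    rw [hnorm k v hv]
    exact hC v hv
  have hinf : ∀ k < m + 1, Tendsto (fun v : ℝ => (v : ℂ) ^ k * F k v) atTop (𝓝 0) := by
    intro k _
    -- The majorant only covers derivatives; for `k = 0` the decay is that of the profile itself.
    rcases Nat.eq_zero_or_pos k with rfl | hk
    · have := (tendsto_powerProfile_atTop hαβ hβ).ofReal
      simpa [F, powerProfileDeriv] using this
    obtain ⟨C, hC⟩ := H k (by omega)
    have h1 := (tendsto_powerProfile_atTop hab hb).const_mul C
    rw [mul_zero] at h1
    refine squeeze_zero_norm' ?_ h1
    filter_upwards [eventually_gt_atTop 0] with v hv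
    rw [hnorm k v hv]
    exact hC v hv
  have hi : ∀ k < m + 1, IntegrableOn (fun v : ℝ => (v : ℂ) ^ k * F (k + 1) v) (Ioi 0) := by
    intro k _
    obtain ⟨C, hC⟩ := H (k + 1) (by omega)
    refine ((integrableOn_powerProfile_div ha hab hb).const_mul C).mono' ?_ ?_
    · refine ContinuousOn.aestronglyMeasurable (fun v hv => ?_) measurableSet_Ioi
      refine ContinuousAt.continuousWithinAt (ContinuousAt.mul (by fun_prop) ?_)
      exact (hasDerivAt_powerProfileDeriv hv (k + 1) γ β).ofReal_comp.continuousAt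
    · filter_upwards [ae_restrict_mem measurableSet_Ioi] with v hv
      have hv0 : 0 < v := hv
      have h1 := hC v hv
      rw [← hnorm (k + 1) v hv, pow_succ', mul_assoc, norm_mul, Complex.norm_real,
        Real.norm_of_nonneg hv0.le] at h1
      rw [← mul_div_assoc, le_div_iff₀ hv0, mul_comm]
      exact h1
  have hw := (hi m (by omega)).const_mul ((-1) ^ (m + 1) / (m.factorial : ℂ))
  obtain ⟨g, hg, hS, -, -⟩ := hΦ.superposition_dilates (S := Unit) (μ := volume.restrict (Ioi (0 : ℝ)))
    (fun _ => hw) (σ := fun v => v ^ q) (by fun_prop)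
    ((ae_restrict_mem measurableSet_Ioi).mono fun v hv => Real.rpow_pos_of_pos hv _)
  refine ⟨g (), hg (), fun x => ?_⟩
  rw [← hS]
  have := eq_integral_truncated_pow hd hc h0 hinf hi (hρ x) hm (lt_add_one m)
  refine Eq.trans this (setIntegral_congr_fun measurableSet_Ioi fun v hv => ?_)
  rw [hhom x v hv]

/-! ### One-dimensional exponentials with complex parameter -/

section laplace

/-- The points `1 + 2πiξ` of the line of integration. -/
noncomputable def laplaceNode (ξ : ℝ) : ℂ := 1 + 2 * Real.pi * ξ * Complex.I

lemma laplaceNode_re (ξ : ℝ) : (laplaceNode ξ).re = 1 := by simp [laplaceNode]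

lemma laplaceNode_im (ξ : ℝ) : (laplaceNode ξ).im = 2 * Real.pi * ξ := by simp [laplaceNode]

@[fun_prop]
lemma continuous_laplaceNode : Continuous laplaceNode := by unfold laplaceNode; fun_prop

lemma one_add_sq_le_norm_laplaceNode_sq (ξ : ℝ) : 1 + ξ ^ 2 ≤ ‖laplaceNode ξ‖ ^ 2 := by
  rw [Complex.sq_norm, Complex.normSq_apply, laplaceNode_re, laplaceNode_im]
  have h : 1 ≤ 2 * Real.pi := by linarith [Real.pi_gt_three]
  nlinarith [sq_nonneg ξ, mul_le_mul h h zero_le_one (by positivity)]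

lemma one_le_norm_laplaceNode (ξ : ℝ) : 1 ≤ ‖laplaceNode ξ‖ := by
  have := Complex.re_le_norm (laplaceNode ξ)
  rwa [laplaceNode_re] at this

lemma laplaceNode_ne_zero (ξ : ℝ) : laplaceNode ξ ≠ 0 :=
  norm_pos_iff.mp (one_pos.trans_le (one_le_norm_laplaceNode ξ))

lemma norm_exp_neg_laplaceNode_mul (ξ u : ℝ) :
    ‖Complex.exp (-(laplaceNode ξ * u))‖ = Real.exp (-u) := by
  rw [Complex.norm_exp]
  simp [laplaceNode_re]

/-- From `(1 + u)³ / 3! ≤ e^(1+u)`. The power `3` is enough because the later majorants grow at most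
like `s^(2p)`, and `2p < 3p`. -/
lemma exp_neg_le_one_add_rpow {u : ℝ} (hu : 0 ≤ u) :
    Real.exp (-u) ≤ 6 * Real.exp 1 * (1 + u) ^ (-(3 : ℝ)) := by
  have h := Real.pow_div_factorial_le_exp (1 + u) (by linarith) 3
  have e : (1 + u) ^ (-(3 : ℝ)) = ((1 + u) ^ 3)⁻¹ := by
    rw [Real.rpow_neg (by linarith)]; norm_cast
  have h6 : ((Nat.factorial 3 : ℕ) : ℝ) = 6 := by norm_num [Nat.factorial]
  rw [h6, div_le_iff₀ (by norm_num), Real.exp_add] at h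
  rw [e, Real.exp_neg, ← div_eq_mul_inv, inv_eq_one_div, div_le_div_iff₀ (Real.exp_pos u) (by positivity)]
  linarith

lemma rpow_mul_exp_neg_rpow_le {p s : ℝ} (a : ℝ) (hs : 0 < s) :
    s ^ a * Real.exp (-s ^ p) ≤ 6 * Real.exp 1 * powerProfile p a 3 s := by
  have h := exp_neg_le_one_add_rpow (Real.rpow_nonneg hs.le p)
  calc s ^ a * Real.exp (-s ^ p) ≤ s ^ a * (6 * Real.exp 1 * (1 + s ^ p) ^ (-(3 : ℝ))) := by gcongr
    _ = _ := by unfold powerProfile; ring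

/-- The function `e^{-z s^p}`, `z = 1 + 2πiξ`, and its first two derivatives in `s`. -/
noncomputable def laplaceExp (p ξ : ℝ) : ℕ → ℝ → ℂ
  | 0, s => Complex.exp (-(laplaceNode ξ * (s ^ p : ℝ)))
  | 1, s => -(laplaceNode ξ * ((p * s ^ (p - 1) : ℝ) : ℂ)) *
      Complex.exp (-(laplaceNode ξ * (s ^ p : ℝ)))
  | _, s => (laplaceNode ξ ^ 2 * ((p ^ 2 * s ^ (2 * p - 2) : ℝ) : ℂ)
      - laplaceNode ξ * ((p * ((p - 1) * s ^ (p - 2)) : ℝ) : ℂ)) *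
      Complex.exp (-(laplaceNode ξ * (s ^ p : ℝ)))

/-- A majorant of the derivatives of `laplaceExp`. -/
noncomputable def laplaceMajorant (p s : ℝ) : ℝ :=
  6 * Real.exp 1 * (p + p ^ 2 + p * |p - 1|) * (powerProfile p p 3 s + powerProfile p (2 * p) 3 s)

lemma laplaceMajorant_nonneg {p s : ℝ} (hp : 0 < p) (hs : 0 < s) : 0 ≤ laplaceMajorant p s :=
  mul_nonneg (by positivity) (add_nonneg (powerProfile_nonneg hs.le) (powerProfile_nonneg hs.le))

lemma tendsto_laplaceMajorant_atTop {p : ℝ} (hp : 0 < p) :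
    Tendsto (laplaceMajorant p) atTop (𝓝 0) := by
  have := ((tendsto_powerProfile_atTop (α := p) (a := p) (b := 3) (by linarith) (by norm_num)).add
    (tendsto_powerProfile_atTop (α := p) (a := 2 * p) (b := 3) (by linarith)
      (by norm_num))).const_mul (6 * Real.exp 1 * (p + p ^ 2 + p * |p - 1|))
  rwa [add_zero, mul_zero] at this

lemma tendsto_laplaceMajorant_nhdsGT_zero {p : ℝ} (hp : 0 < p) :
    Tendsto (laplaceMajorant p) (𝓝[>] 0) (𝓝 0) := by
  have := ((tendsto_powerProfile_nhdsGT_zero (α := p) (a := p) (b := 3) hp (by norm_num)).add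
    (tendsto_powerProfile_nhdsGT_zero (α := p) (a := 2 * p) (b := 3) (by linarith)
      (by norm_num))).const_mul (6 * Real.exp 1 * (p + p ^ 2 + p * |p - 1|))
  rwa [add_zero, mul_zero] at this

lemma integrableOn_laplaceMajorant_div {p : ℝ} (hp : 0 < p) :
    IntegrableOn (fun s => laplaceMajorant p s / s) (Ioi 0) := by
  simp only [laplaceMajorant, mul_div_assoc, add_div]
  exact ((integrableOn_powerProfile_div hp (by linarith) (by norm_num)).add
    (integrableOn_powerProfile_div (by linarith) (by linarith) (by norm_num))).const_mul _

lemma hasDerivAt_laplaceExp {p ξ s : ℝ} (hs : 0 < s) {k : ℕ} (hk : k < 2) :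
    HasDerivAt (laplaceExp p ξ k) (laplaceExp p ξ (k + 1) s) s := by
  have h0 : HasDerivAt (laplaceExp p ξ 0) (laplaceExp p ξ 1 s) s := by
    have h1 := (Real.hasDerivAt_rpow_const (p := p) (Or.inl hs.ne')).ofReal_comp
    refine ((h1.const_mul (laplaceNode ξ)).neg).cexp.congr_deriv ?_
    simp only [laplaceExp, Pi.neg_apply]
    ring
  interval_cases k
  · exact h0
  · have h1 := (((Real.hasDerivAt_rpow_const (p := p - 1)
      (Or.inl hs.ne')).const_mul p).ofReal_comp.const_mul (laplaceNode ξ)).neg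
    have h2 : HasDerivAt (laplaceExp p ξ 1) _ s := h1.mul h0
    refine h2.congr_deriv ?_
    have e1 : s ^ (2 * p - 2) = s ^ (p - 1) * s ^ (p - 1) := by
      rw [← Real.rpow_add hs]; congr 1; ring
    have e2 : p - 1 - 1 = p - 2 := by ring
    simp only [laplaceExp, e1, e2, Pi.neg_apply]
    push_cast
    ring

lemma measurable_laplaceExp (p : ℝ) (k : ℕ) : Measurable fun q : ℝ × ℝ => laplaceExp p q.1 k q.2 := by
  have hz : Measurable fun q : ℝ × ℝ => laplaceNode q.1 :=
    continuous_laplaceNode.measurable.comp measurable_fst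
  match k with
  | 0 => simp only [laplaceExp]; fun_prop
  | 1 => simp only [laplaceExp]; fun_prop
  | _ + 2 => simp only [laplaceExp]; fun_prop

lemma norm_laplaceExp_one_le {p s : ℝ} (hp : 0 < p) (ξ : ℝ) (hs : 0 < s) :
    s * ‖laplaceExp p ξ 1 s‖ ≤ ‖laplaceNode ξ‖ ^ 2 * laplaceMajorant p s := by
  have h1 := one_le_norm_laplaceNode ξ
  have h2 : ‖laplaceNode ξ‖ ≤ ‖laplaceNode ξ‖ ^ 2 := le_self_pow₀ h1 two_ne_zero
  have h3 : s * s ^ (p - 1) = s ^ p := by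
    rw [Real.rpow_sub_one hs.ne']; field_simp
  have h4 : p ≤ p + p ^ 2 + p * |p - 1| := by
    have : 0 ≤ p ^ 2 + p * |p - 1| := by positivity
    linarith
  have h5 : s ^ p * Real.exp (-s ^ p)
      ≤ 6 * Real.exp 1 * (powerProfile p p 3 s + powerProfile p (2 * p) 3 s) :=
    (rpow_mul_exp_neg_rpow_le p hs).trans (mul_le_mul_of_nonneg_left
      (le_add_of_nonneg_right (powerProfile_nonneg hs.le)) (by positivity))
  calc s * ‖laplaceExp p ξ 1 s‖ = ‖laplaceNode ξ‖ * p * ((s * s ^ (p - 1)) * Real.exp (-s ^ p)) := by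
        simp only [laplaceExp, norm_mul, norm_neg, norm_exp_neg_laplaceNode_mul, Complex.norm_real,
          Real.norm_of_nonneg hp.le, Real.norm_of_nonneg (Real.rpow_nonneg hs.le _)]
        ring
    _ = ‖laplaceNode ξ‖ * p * (s ^ p * Real.exp (-s ^ p)) := by rw [h3]
    _ ≤ ‖laplaceNode ξ‖ ^ 2 * (p + p ^ 2 + p * |p - 1|) *
          (6 * Real.exp 1 * (powerProfile p p 3 s + powerProfile p (2 * p) 3 s)) :=
        mul_le_mul (mul_le_mul h2 h4 hp.le (by positivity)) h5 (by positivity) (by positivity)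
    _ = _ := by unfold laplaceMajorant; ring

lemma norm_laplaceExp_two_le {p s : ℝ} (hp : 0 < p) (ξ : ℝ) (hs : 0 < s) :
    s ^ 2 * ‖laplaceExp p ξ 2 s‖ ≤ ‖laplaceNode ξ‖ ^ 2 * laplaceMajorant p s := by
  have h1 := one_le_norm_laplaceNode ξ
  have h2 : ‖laplaceNode ξ‖ ≤ ‖laplaceNode ξ‖ ^ 2 := le_self_pow₀ h1 two_ne_zero
  have h3 : s ^ 2 * s ^ (p - 2) = s ^ p := by
    rw [← Real.rpow_natCast, ← Real.rpow_add hs]; congr 1; push_cast; ring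
  have h3' : s ^ 2 * s ^ (2 * p - 2) = s ^ (2 * p) := by
    rw [← Real.rpow_natCast, ← Real.rpow_add hs]; congr 1; push_cast; ring
  set M := powerProfile p p 3 s + powerProfile p (2 * p) 3 s with hM
  have hM0 : 0 ≤ M := add_nonneg (powerProfile_nonneg hs.le) (powerProfile_nonneg hs.le)
  have h5 : s ^ p * Real.exp (-s ^ p) ≤ 6 * Real.exp 1 * M :=
    (rpow_mul_exp_neg_rpow_le p hs).trans (mul_le_mul_of_nonneg_left
      (le_add_of_nonneg_right (powerProfile_nonneg hs.le)) (by positivity))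
  have h6 : s ^ (2 * p) * Real.exp (-s ^ p) ≤ 6 * Real.exp 1 * M :=
    (rpow_mul_exp_neg_rpow_le (2 * p) hs).trans (mul_le_mul_of_nonneg_left
      (le_add_of_nonneg_left (powerProfile_nonneg hs.le)) (by positivity))
  set Z := ‖laplaceNode ξ‖ with hZ
  calc s ^ 2 * ‖laplaceExp p ξ 2 s‖
      ≤ s ^ 2 * ((Z ^ 2 * (p ^ 2 * s ^ (2 * p - 2)) + Z * (p * (|p - 1| * s ^ (p - 2))))
        * Real.exp (-s ^ p)) := by
        simp only [laplaceExp]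
        rw [norm_mul, norm_exp_neg_laplaceNode_mul]
        gcongr
        refine (norm_sub_le _ _).trans (le_of_eq ?_)
        simp only [norm_mul, norm_pow, Complex.norm_real, Real.norm_of_nonneg hp.le,
          Real.norm_of_nonneg (Real.rpow_nonneg hs.le _), Real.norm_eq_abs (p - 1), hZ]
    _ = Z ^ 2 * p ^ 2 * ((s ^ 2 * s ^ (2 * p - 2)) * Real.exp (-s ^ p))
        + Z * (p * |p - 1|) * ((s ^ 2 * s ^ (p - 2)) * Real.exp (-s ^ p)) := by ring
    _ = Z ^ 2 * p ^ 2 * (s ^ (2 * p) * Real.exp (-s ^ p))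
        + Z * (p * |p - 1|) * (s ^ p * Real.exp (-s ^ p)) := by rw [h3, h3']
    _ ≤ Z ^ 2 * p ^ 2 * (6 * Real.exp 1 * M) + Z ^ 2 * (p * |p - 1|) * (6 * Real.exp 1 * M) := by
        gcongr
    _ = 6 * Real.exp 1 * (p ^ 2 + p * |p - 1|) * Z ^ 2 * M := by ring
    _ ≤ 6 * Real.exp 1 * (p + p ^ 2 + p * |p - 1|) * Z ^ 2 * M := by
        gcongr
        linarith
    _ = _ := by rw [laplaceMajorant, ← hM]; ring

/-- The dependence on `z` is at most quadratic: terms linear in `|z|` are absorbed because `|z| ≥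
1`. This makes the `L₁` norms of the preimages `O(|z|²)`. -/
lemma norm_pow_mul_laplaceExp_le {p s : ℝ} (hp : 0 < p) (ξ : ℝ) (hs : 0 < s) {k : ℕ} (hk : k < 2) :
    ‖(s : ℂ) ^ k * laplaceExp p ξ (k + 1) s‖
      ≤ ‖laplaceNode ξ‖ ^ 2 * (laplaceMajorant p s / s) := by
  rw [← mul_div_assoc, le_div_iff₀ hs, norm_mul, norm_pow, Complex.norm_real,
    Real.norm_of_nonneg hs.le]
  interval_cases k
  · refine le_trans (le_of_eq ?_) (norm_laplaceExp_one_le hp ξ hs)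
    ring
  · refine le_trans (le_of_eq ?_) (norm_laplaceExp_two_le hp ξ hs)
    ring

lemma integrableOn_pow_mul_laplaceExp {p : ℝ} (hp : 0 < p) (ξ : ℝ) {k : ℕ} (hk : k < 2) :
    IntegrableOn (fun s : ℝ => (s : ℂ) ^ k * laplaceExp p ξ (k + 1) s) (Ioi 0) := by
  have hm : Measurable (laplaceExp p ξ (k + 1)) :=
    (measurable_laplaceExp p (k + 1)).comp (measurable_const.prodMk measurable_id)
  refine ((integrableOn_laplaceMajorant_div hp).const_mul (‖laplaceNode ξ‖ ^ 2)).mono'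
    (Measurable.aestronglyMeasurable (by fun_prop)) ?_
  filter_upwards [ae_restrict_mem measurableSet_Ioi] with s hs
    using norm_pow_mul_laplaceExp_le hp ξ hs hk

lemma tendsto_mul_laplaceExp {p : ℝ} (hp : 0 < p) (ξ : ℝ) {l : Filter ℝ} (hl : ∀ᶠ s in l, 0 < s)
    (hM : Tendsto (laplaceMajorant p) l (𝓝 0)) :
    Tendsto (fun s : ℝ => (s : ℂ) ^ 1 * laplaceExp p ξ 1 s) l (𝓝 0) := by
  have h1 := hM.const_mul (‖laplaceNode ξ‖ ^ 2)
  rw [mul_zero] at h1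
  refine squeeze_zero_norm' ?_ h1
  filter_upwards [hl] with s hs
  rw [pow_one, norm_mul, Complex.norm_real, Real.norm_of_nonneg hs.le]
  exact norm_laplaceExp_one_le hp ξ hs

lemma laplaceExp_eq_integral {p : ℝ} (hp : 0 < p) (ξ : ℝ) {u : ℝ} (hu : 0 ≤ u) :
    laplaceExp p ξ 0 u = ∫ s in Ioi (0 : ℝ),
      ((s : ℂ) ^ 1 * laplaceExp p ξ 2 s) * ((max 0 (1 - u / s) : ℝ) : ℂ) := by
  have := eq_integral_truncated_pow (F := laplaceExp p ξ) (n := 2)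
    (fun k hk s hs => hasDerivAt_laplaceExp hs hk) ?_ ?_ ?_
    (fun k hk => integrableOn_pow_mul_laplaceExp hp ξ hk) hu one_ne_zero one_lt_two
  · simpa using this
  · refine ContinuousAt.continuousWithinAt ?_
    have := Real.continuousAt_rpow_const 0 p (Or.inr hp.le)
    unfold laplaceExp
    fun_prop
  · intro k hk1 hk2
    obtain rfl : k = 1 := by omega
    exact tendsto_mul_laplaceExp hp ξ eventually_mem_nhdsWithin
      (tendsto_laplaceMajorant_nhdsGT_zero hp)
  · intro k hk
    interval_cases k
    · rw [tendsto_zero_iff_norm_tendsto_zero]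
      simp only [pow_zero, one_mul, laplaceExp, norm_exp_neg_laplaceNode_mul]
      exact Real.tendsto_exp_neg_atTop_nhds_zero.comp (tendsto_rpow_atTop hp)
    · exact tendsto_mul_laplaceExp hp ξ (eventually_gt_atTop 0) (tendsto_laplaceMajorant_atTop hp)

/-- The functions `e^{-z|x|^p}`, `Re z = 1`, as Fourier transforms of integrable functions. -/
lemma exists_wiener_exp_neg_rpow {p : ℝ} (hp : 0 < p) : ∃ g : ℝ → ℝ → ℂ,
    StronglyMeasurable (Function.uncurry g) ∧ (∀ ξ, Integrable (g ξ)) ∧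
    (∀ ξ x, Complex.exp (-(laplaceNode ξ * (|x| ^ p : ℝ))) = ∫ y, g ξ y * wienerChar x y) ∧
    ∃ C : ℝ, 0 ≤ C ∧ ∀ ξ, ∫ y, ‖g ξ y‖ ≤ C * ‖laplaceNode ξ‖ ^ 2 := by
  have hi := fun ξ => integrableOn_pow_mul_laplaceExp hp ξ one_lt_two
  have hMi := integrableOn_laplaceMajorant_div hp
  obtain ⟨g, hg, hS, hgm, C, hC⟩ := isWiener_tent.superposition_dilates
    (μ := volume.restrict (Ioi (0 : ℝ))) (w := fun ξ s => (s : ℂ) ^ 1 * laplaceExp p ξ 2 s)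
    hi (σ := id) measurable_id (ae_restrict_mem measurableSet_Ioi)
  refine ⟨g, hgm (Measurable.stronglyMeasurable ?_), hg, fun ξ x => ?_,
    |C| * ∫ s in Ioi (0 : ℝ), laplaceMajorant p s / s, ?_, fun ξ => ?_⟩
  · have := measurable_laplaceExp p 2
    simp only [Function.uncurry_def]
    fun_prop
  · rw [← hS]
    refine (laplaceExp_eq_integral hp ξ (abs_nonneg x)).trans
      (setIntegral_congr_fun measurableSet_Ioi fun s hs => ?_)
    have hs0 : 0 < s := hs
    simp only [id, smul_eq_mul, abs_mul, abs_inv, abs_of_pos hs0]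
    rw [div_eq_inv_mul]
  · refine mul_nonneg (abs_nonneg _) (setIntegral_nonneg measurableSet_Ioi fun s hs => ?_)
    exact div_nonneg (laplaceMajorant_nonneg hp hs) (le_of_lt hs)
  · have h1 : ∫ s in Ioi (0 : ℝ), ‖(s : ℂ) ^ 1 * laplaceExp p ξ 2 s‖
        ≤ ∫ s in Ioi (0 : ℝ), ‖laplaceNode ξ‖ ^ 2 * (laplaceMajorant p s / s) :=
      setIntegral_mono_on (hi ξ).norm (hMi.const_mul _) measurableSet_Ioi fun s hs =>
        norm_pow_mul_laplaceExp_le hp ξ hs one_lt_two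
    rw [integral_const_mul] at h1
    have h0 : 0 ≤ ∫ s in Ioi (0 : ℝ), ‖(s : ℂ) ^ 1 * laplaceExp p ξ 2 s‖ :=
      integral_nonneg fun _ => norm_nonneg _
    calc ∫ y, ‖g ξ y‖ ≤ |C| * ∫ s in Ioi (0 : ℝ), ‖(s : ℂ) ^ 1 * laplaceExp p ξ 2 s‖ :=
          (hC ξ).trans (mul_le_mul_of_nonneg_right (le_abs_self C) h0)
      _ ≤ |C| * (‖laplaceNode ξ‖ ^ 2 * ∫ s in Ioi (0 : ℝ), laplaceMajorant p s / s) := by gcongr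
      _ = _ := by ring

end laplace

/-! ### Laplace inversion -/

section laplaceInversion

lemma integrableOn_pow_mul_exp_neg (m : ℕ) :
    IntegrableOn (fun v : ℝ => v ^ m * Real.exp (-v)) (Ioi 0) := by
  have h := Real.GammaIntegral_convergent (s := m + 1) (by positivity)
  simpa [mul_comm] using h

/-- This is Taylor's formula at infinity for `e^{-zv}`, evaluated at `u = 0`. -/
lemma integral_pow_mul_exp_neg_laplaceNode (m : ℕ) (ξ : ℝ) :
    ∫ v in Ioi (0 : ℝ), (v : ℂ) ^ m * Complex.exp (-(laplaceNode ξ * v))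
      = m.factorial / laplaceNode ξ ^ (m + 1) := by
  have hz := laplaceNode_ne_zero ξ
  set z := laplaceNode ξ with hzdef
  have hn : ∀ (j k : ℕ) (v : ℝ), 0 < v → ‖(v : ℂ) ^ k * ((-z) ^ j * Complex.exp (-(z * v)))‖
      = ‖z‖ ^ j * (v ^ k * Real.exp (-v)) := by
    intro j k v hv
    rw [norm_mul, norm_mul, norm_exp_neg_laplaceNode_mul, norm_pow, norm_pow, norm_neg,
      Complex.norm_real, Real.norm_of_nonneg hv.le]
    ring
  have hd : ∀ (k : ℕ) (v : ℝ), HasDerivAt (fun v : ℝ => (-z) ^ k * Complex.exp (-(z * v)))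
      ((-z) ^ (k + 1) * Complex.exp (-(z * v))) v := by
    intro k v
    have h1 := (((hasDerivAt_id v).ofReal_comp.const_mul z).neg.cexp).const_mul ((-z) ^ k)
    refine h1.congr_deriv ?_
    simp only [Pi.neg_apply, id]
    push_cast
    ring
  have h := eq_integral_Ioi_of_hasDerivAt (n := m + 1)
    (F := fun k (v : ℝ) => (-z) ^ k * Complex.exp (-(z * v))) (fun k _ v _ => hd k v)
    (hd 0 0).continuousAt.continuousWithinAt ?_ ?_ ?_ le_rfl m (lt_add_one m)
  · have hm : (m.factorial : ℂ) ≠ 0 := by exact_mod_cast m.factorial_ne_zero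
    simp only [sub_zero, Complex.ofReal_zero, mul_zero, neg_zero, Complex.exp_zero, pow_zero,
      mul_one] at h
    have e : ∀ v : ℝ, (v : ℂ) ^ m * ((-z) ^ (m + 1) * Complex.exp (-(z * v)))
        = (-1) ^ (m + 1) * z ^ (m + 1) * ((v : ℂ) ^ m * Complex.exp (-(z * v))) := fun v => by
      rw [neg_pow]; ring
    simp_rw [e] at h
    rw [integral_const_mul] at h
    have e2 : ((-1 : ℂ) ^ (m + 1)) * (-1) ^ (m + 1) = 1 := by
      rw [← mul_pow]; simp
    rw [eq_div_iff (pow_ne_zero _ hz)]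
    set I := ∫ v in Ioi (0 : ℝ), (v : ℂ) ^ m * Complex.exp (-(z * v))
    have h3 : (1 : ℂ) = ((-1) ^ (m + 1) * (-1) ^ (m + 1)) * (z ^ (m + 1) * I) / m.factorial := by
      refine h.trans ?_
      ring
    rw [e2, one_mul, eq_div_iff hm, one_mul] at h3
    rw [h3]; ring
  · intro k hk _
    have hc : Continuous fun v : ℝ => (v : ℂ) ^ k * ((-z) ^ k * Complex.exp (-(z * v))) := by fun_prop
    have := hc.tendsto 0
    simp only [Complex.ofReal_zero] at this
    rw [zero_pow (by omega), zero_mul] at this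
    exact this.mono_left nhdsWithin_le_nhds
  · intro k _
    have h1 := (Real.tendsto_pow_mul_exp_neg_atTop_nhds_zero k).const_mul (‖z‖ ^ k)
    rw [mul_zero] at h1
    refine squeeze_zero_norm' ?_ h1
    filter_upwards [eventually_gt_atTop 0] with v hv using (hn k k v hv).le
  · intro k _
    refine ((integrableOn_pow_mul_exp_neg k).const_mul (‖z‖ ^ (k + 1))).mono'
      (Continuous.aestronglyMeasurable (by fun_prop)) ?_
    filter_upwards [ae_restrict_mem measurableSet_Ioi] with v hv using (hn (k + 1) k v hv).le

lemma integrable_inv_norm_laplaceNode_sq : Integrable fun ξ => (‖laplaceNode ξ‖ ^ 2)⁻¹ := by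
  refine integrable_inv_one_add_sq.mono' (Measurable.aestronglyMeasurable
    (by have := continuous_laplaceNode.measurable; fun_prop)) (ae_of_all _ fun ξ => ?_)
  rw [Real.norm_of_nonneg (by positivity)]
  exact inv_anti₀ (by positivity) (one_add_sq_le_norm_laplaceNode_sq ξ)

/-- Laplace inversion for truncated powers. -/
lemma truncated_pow_eq_integral {m : ℕ} (hm : m ≠ 0) (u : ℝ) :
    ((max 0 (1 - u) : ℝ) : ℂ) ^ m = ∫ ξ, (m.factorial / laplaceNode ξ ^ (m + 1) *
      Complex.exp (laplaceNode ξ)) * Complex.exp (-(laplaceNode ξ * u)) := by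
  -- The damping `e^{-v}` makes `v_+^m` integrable, with transform `m! / z^(m+1)`. Inversion at `1 -
  -- u` and multiplication by `e^(1-u)` undo it. For `m = 0` the function `K` would not vanish on
  -- the negative axis.
  set K : ℝ → ℂ := fun v => (((max 0 v) ^ m * Real.exp (-v) : ℝ) : ℂ)
  have hKc : Continuous K := by fun_prop
  have hK0 : ∀ v, v ∉ Ioi (0 : ℝ) → K v = 0 := fun v hv => by
    have hv' : v ≤ 0 := not_lt.mp hv
    simp only [K, max_eq_left hv', zero_pow hm, zero_mul, Complex.ofReal_zero]
  have hKi : Integrable K := by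
    rw [← integrableOn_iff_integrable_of_support_subset (s := Ioi (0 : ℝ))
      fun v hv => by_contra fun h => hv (hK0 v h)]
    have h : IntegrableOn (fun v : ℝ => ((v ^ m * Real.exp (-v) : ℝ) : ℂ)) (Ioi 0) :=
      (integrableOn_pow_mul_exp_neg m).ofReal
    refine h.congr_fun (fun v hv => ?_) measurableSet_Ioi
    have hv' : 0 ≤ v := le_of_lt (mem_Ioi.mp hv)
    simp only [K, max_eq_right hv']
  have hF : ∀ ξ, FourierTransform.fourier K ξ = m.factorial / laplaceNode ξ ^ (m + 1) := by
    intro ξ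
    rw [Real.fourier_real_eq_integral_exp_smul, ← integral_pow_mul_exp_neg_laplaceNode,
      ← setIntegral_eq_integral_of_forall_compl_eq_zero (s := Ioi (0 : ℝ))
        fun v hv => by rw [hK0 v hv, smul_zero]]
    refine setIntegral_congr_fun measurableSet_Ioi fun v hv => ?_
    have hv' : 0 ≤ v := le_of_lt (mem_Ioi.mp hv)
    simp only [K, max_eq_right hv', smul_eq_mul]
    push_cast
    rw [mul_left_comm, ← Complex.exp_add]
    congr 2
    simp only [laplaceNode]
    ring
  have hFi : Integrable (FourierTransform.fourier K) := by
    rw [funext hF]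
    refine (integrable_inv_norm_laplaceNode_sq.const_mul (m.factorial : ℝ)).mono'
      (Measurable.aestronglyMeasurable (by have := continuous_laplaceNode.measurable; fun_prop))
      (ae_of_all _ fun ξ => ?_)
    rw [norm_div, norm_pow, Complex.norm_natCast, div_eq_mul_inv]
    gcongr
    · have := one_le_norm_laplaceNode ξ
      positivity
    · exact one_le_norm_laplaceNode ξ
    · omega
  have h := congrFun (hKc.fourierInv_fourier_eq hKi hFi) (1 - u)
  rw [Real.fourierInv_eq'] at h
  have h1 : ((max 0 (1 - u) : ℝ) : ℂ) ^ m = Complex.exp ((1 - u : ℝ)) * K (1 - u) := by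
    simp only [K]
    push_cast
    rw [mul_left_comm, ← Complex.exp_add, add_neg_cancel, Complex.exp_zero, mul_one]
  rw [h1, ← h, ← integral_const_mul]
  refine integral_congr_ae (ae_of_all _ fun ξ => ?_)
  simp only [hF, smul_eq_mul]
  rw [← mul_assoc, ← Complex.exp_add, mul_assoc _ (Complex.exp _) (Complex.exp _),
    ← Complex.exp_add, mul_comm]
  congr 2
  simp only [laplaceNode, RCLike.inner_apply, conj_trivial]
  push_cast
  ring

end laplaceInversion

/-! ### Truncated powers of the sum of powers -/

section truncatedPower

variable {d : ℕ}

lemma prod_wienerChar (x y : EuclideanSpace ℝ (Fin d)) :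
    ∏ j, wienerChar (x j) (y j) = wienerChar x y := by
  simp only [wienerChar]
  rw [← Complex.exp_sum]
  congr 1
  simp [PiLp.inner_apply, Finset.mul_sum]

/-- The truncated powers `(1 - ∑ |x_j|^p)_+^(2d+1)` are Fourier transforms of integrable functions. -/
lemma isWiener_truncated_pow_sum {p : ℝ} (hp : 0 < p) :
    IsWiener fun x : EuclideanSpace ℝ (Fin d) =>
      ((max 0 (1 - ∑ j, |x j| ^ p) : ℝ) : ℂ) ^ (2 * d + 1) := by
  obtain ⟨g, hgm, hg, hrep, C, hC0, hC⟩ := exists_wiener_exp_neg_rpow hp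
  -- The product of `d` preimages has `L₁` norm `O(|z|^(2d))`; against `|z|^(-(m+1)) = |z|^(-2d-2)`
  -- this leaves the integrable `|z|^(-2)`.
  set m := 2 * d + 1
  set c : ℝ → ℂ := fun ξ => m.factorial / laplaceNode ξ ^ (m + 1) * Complex.exp (laplaceNode ξ)
  have hcm : Measurable c := by
    have := continuous_laplaceNode.measurable
    fun_prop
  have hcn : ∀ ξ, ‖c ξ‖ = m.factorial * Real.exp 1 * (‖laplaceNode ξ‖ ^ (m + 1))⁻¹ := by
    intro ξ
    simp only [c, norm_mul, norm_div, norm_pow, Complex.norm_natCast, Complex.norm_exp,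
      laplaceNode_re]
    ring
  set G : ℝ → EuclideanSpace ℝ (Fin d) → ℂ := fun ξ y => c ξ * ∏ j, g ξ (y j)
  have hGm : StronglyMeasurable (Function.uncurry G) := by
    refine Measurable.stronglyMeasurable ((hcm.comp measurable_fst).mul
      (Finset.measurable_prod _ fun j _ => ?_))
    exact hgm.measurable.comp (g := Function.uncurry g)
      (f := fun q : ℝ × EuclideanSpace ℝ (Fin d) => (q.1, q.2 j)) (by fun_prop)
  have hGn : ∀ ξ, ∫ y, ‖G ξ y‖ = ‖c ξ‖ * (∫ y, ‖g ξ y‖) ^ d := by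
    intro ξ
    simp only [G, norm_mul, norm_prod]
    rw [integral_const_mul]
    congr 1
    have h1 : ∫ y : EuclideanSpace ℝ (Fin d), ∏ j, ‖g ξ (y j)‖
        = ∫ y : Fin d → ℝ, ∏ j, ‖g ξ (y j)‖ :=
      (EuclideanSpace.volume_preserving_symm_measurableEquiv_toLp (Fin d)).integral_comp'
        (fun x : Fin d → ℝ => ∏ j, ‖g ξ (x j)‖)
    rw [h1, integral_fintype_prod_volume_eq_prod (fun (_ : Fin d) y => ‖g ξ y‖)]
    simp
  have hGi : Integrable (Function.uncurry G) (volume.prod volume) := by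
    rw [integrable_prod_iff hGm.aestronglyMeasurable]
    refine ⟨ae_of_all _ fun ξ => (integrable_euclidean_prod fun _ => hg ξ).const_mul (c ξ), ?_⟩
    refine (integrable_inv_norm_laplaceNode_sq.const_mul (m.factorial * Real.exp 1 * C ^ d)).mono'
      hGm.norm.integral_prod_right'.aestronglyMeasurable (ae_of_all _ fun ξ => ?_)
    rw [Real.norm_of_nonneg (integral_nonneg fun _ => norm_nonneg _)]
    refine (hGn ξ).le.trans ?_
    have hz : 0 < ‖laplaceNode ξ‖ := one_pos.trans_le (one_le_norm_laplaceNode ξ)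
    rw [hcn]
    calc (m.factorial * Real.exp 1 * (‖laplaceNode ξ‖ ^ (m + 1))⁻¹) * (∫ y, ‖g ξ y‖) ^ d
        ≤ (m.factorial * Real.exp 1 * (‖laplaceNode ξ‖ ^ (m + 1))⁻¹) *
          (C * ‖laplaceNode ξ‖ ^ 2) ^ d := by
          have h0 : 0 ≤ ∫ y, ‖g ξ y‖ := integral_nonneg fun y => norm_nonneg (g ξ y)
          exact mul_le_mul_of_nonneg_left (pow_le_pow_left₀ h0 (hC ξ) d) (by positivity)
      _ = _ := by
          have e : ‖laplaceNode ξ‖ ^ (m + 1) = (‖laplaceNode ξ‖ ^ 2) ^ d * ‖laplaceNode ξ‖ ^ 2 := by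
            simp only [m]; ring
          rw [e, mul_pow]
          field_simp
  refine ⟨fun y => ∫ ξ, G ξ y, hGi.integral_prod_right, fun x => ?_⟩
  rw [← integral_integral_mul_wienerChar hGi]
  refine (truncated_pow_eq_integral (by omega) _).trans ?_
  refine integral_congr_ae (ae_of_all _ fun ξ => ?_)
  simp only [G, mul_assoc, integral_const_mul]
  simp_rw [← prod_wienerChar, ← Finset.prod_mul_distrib]
  rw [integral_euclidean_prod (fun j y => g ξ y * wienerChar (x j) y)]
  simp_rw [← hrep]
  rw [← Complex.exp_sum]
  simp only [c, mul_assoc]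
  congr 4
  push_cast
  rw [Finset.mul_sum, Finset.sum_neg_distrib]

end truncatedPower

/-! ### Necessity and the final equivalence -/

lemma lpAbs_single {d : ℕ} {p : ENNReal} (hp : 0 < p) (i : Fin d) (t : ℝ) :
    lpAbs p (EuclideanSpace.single i t) = |t| := by
  unfold lpAbs
  split_ifs with h
  · rw [iSup_abs_eq_norm]
    have : WithLp.ofLp (EuclideanSpace.single i t) = Pi.single i t := by
      ext j; simp [Pi.single_apply]
    rw [this, Pi.norm_single, Real.norm_eq_abs]
  · have hp0 : p.toReal ≠ 0 := (ENNReal.toReal_pos hp.ne' h).ne'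
    rw [Finset.sum_eq_single i]
    · rw [PiLp.single_apply, if_pos rfl, ← Real.rpow_mul (abs_nonneg t),
        mul_one_div_cancel hp0, Real.rpow_one]
    · intro j _ hj
      rw [PiLp.single_apply, if_neg hj, abs_zero, Real.zero_rpow hp0]
    · simp

lemma powerProfile_eq_div {α γ β t : ℝ} (ht : 0 ≤ t) :
    powerProfile α γ β t = t ^ γ / (1 + t ^ α) ^ β := by
  have : 0 ≤ 1 + t ^ α := by positivity
  rw [powerProfile, Real.rpow_neg this, div_eq_mul_inv]

/-- A profile that is bounded near the origin has a nonnegative exponent. -/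
lemma nonneg_of_powerProfile_le {α γ β C : ℝ} (hα : 0 ≤ α)
    (h : ∀ t > 0, |powerProfile α γ β t| ≤ C) : 0 ≤ γ := by
  by_contra! hγ
  have hC : 0 ≤ C := (abs_nonneg _).trans (h 1 one_pos)
  -- Choose `t ≤ 1` with `t^γ = A + 1`. Since `(1 + t^α)^β ≤ 2^|β|` there, the bound `C` would give
  -- `A + 1 ≤ A`.
  set A : ℝ := C * 2 ^ |β|
  have hA : 0 ≤ A := by positivity
  set t : ℝ := (A + 1) ^ (1 / γ)
  have ht0 : 0 < t := by positivity
  have ht1 : t ≤ 1 := Real.rpow_le_one_of_one_le_of_nonpos (by linarith)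
    (one_div_nonpos.mpr hγ.le)
  have htγ : t ^ γ = A + 1 := by
    rw [← Real.rpow_mul (by positivity), one_div_mul_cancel hγ.ne, Real.rpow_one]
  have h1 := h t ht0
  rw [abs_of_nonneg (powerProfile_nonneg ht0.le), powerProfile_eq_div ht0.le, htγ,
    div_le_iff₀ (by positivity)] at h1
  have h2 : (1 + t ^ α) ^ β ≤ 2 ^ |β| := by
    have h3 : t ^ α ≤ 1 := Real.rpow_le_one ht0.le ht1 hα
    have h4 : 0 ≤ t ^ α := by positivity
    exact (Real.rpow_le_rpow_of_exponent_le (by linarith) (le_abs_self β)).trans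
      (Real.rpow_le_rpow (by linarith) (by linarith) (abs_nonneg β))
  have h3 := mul_le_mul_of_nonneg_left h2 hC
  linarith

/-- A profile that tends to zero at infinity has a negative exponent there. -/
lemma lt_mul_of_tendsto_powerProfile {α γ β : ℝ} (hα : 0 ≤ α) (hγ : 0 ≤ γ)
    (h : Tendsto (powerProfile α γ β) atTop (𝓝 0)) : γ < α * β := by
  by_contra! hle
  -- If `αβ ≤ γ`, the profile stays above `2^(-|β|)` on `[1, ∞)`; for `β ≥ 0` this uses `1 + t^α ≤ 2
  -- t^α`.
  have hb : ∀ t : ℝ, 1 ≤ t → ((2 : ℝ) ^ |β|)⁻¹ ≤ powerProfile α γ β t := by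
    intro t ht
    have ht0 : 0 < t := by linarith
    have hα1 : 1 ≤ t ^ α := Real.one_le_rpow ht hα
    have hγ1 : 1 ≤ t ^ γ := Real.one_le_rpow ht hγ
    have h2 : 1 ≤ (2 : ℝ) ^ |β| := Real.one_le_rpow one_le_two (abs_nonneg β)
    rw [powerProfile_eq_div ht0.le, inv_eq_one_div, div_le_div_iff₀ (by positivity) (by positivity),
      one_mul]
    rcases le_total 0 β with hβ | hβ
    · calc (1 + t ^ α) ^ β ≤ (t ^ α * 2) ^ β :=
            Real.rpow_le_rpow (by positivity) (by linarith) hβ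
        _ = t ^ (α * β) * 2 ^ |β| := by
            rw [Real.mul_rpow (by positivity) zero_le_two, ← Real.rpow_mul ht0.le, abs_of_nonneg hβ]
        _ ≤ _ := by
            gcongr
    · calc (1 + t ^ α) ^ β ≤ 1 := Real.rpow_le_one_of_one_le_of_nonpos (by linarith) hβ
        _ ≤ _ := one_le_mul_of_one_le_of_one_le hγ1 h2
  have h1 : ((2 : ℝ) ^ |β|)⁻¹ ≤ 0 :=
    ge_of_tendsto h ((eventually_ge_atTop 1).mono hb)
  have h2 : 0 < ((2 : ℝ) ^ |β|)⁻¹ := by positivity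
  linarith

lemma isWiener_powerProfile_lpAbs {d : ℕ} (hd : 1 ≤ d) {p : ENNReal} (hp : 0 < p) {α β γ : ℝ}
    (hα : 0 < α) (hαβ : γ < α * β) (hγ : 0 ≤ γ) :
    IsWiener fun x : EuclideanSpace ℝ (Fin d) => (powerProfile α γ β (lpAbs p x) : ℂ) := by
  by_cases h : p = ⊤
  · simp only [lpAbs, if_pos h]
    refine isWiener_powerProfile_comp (q := 1) (m := 1)
      (fun x => Real.iSup_nonneg fun j => abs_nonneg _) (fun x v hv => ?_) one_ne_zero ?_ hα hγ hαβ
    · rw [iSup_abs_eq_norm, iSup_abs_eq_norm, Real.rpow_one, WithLp.ofLp_smul, norm_smul, norm_inv,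
        Real.norm_of_nonneg hv.le, div_eq_inv_mul]
    · simpa only [pow_one, cubeTent] using isWiener_cubeTent hd
  · simp only [lpAbs, if_neg h]
    set P := p.toReal
    have hP : 0 < P := ENNReal.toReal_pos hp.ne' h
    have hρ : ∀ x : EuclideanSpace ℝ (Fin d), 0 ≤ ∑ j, |x j| ^ P := fun x =>
      Finset.sum_nonneg fun j _ => by positivity
    -- The gauge is the sum of powers without the outer root, so `α` and `γ` are divided by `P`; it
    -- scales by `v⁻¹` when `x` is scaled by `v^(-1/P)`.
    have hW := isWiener_powerProfile_comp (q := 1 / P) hρ (fun x v hv => ?_)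
      (Nat.succ_ne_zero (2 * d)) (isWiener_truncated_pow_sum hP) (div_pos hα hP)
      (div_nonneg hγ hP.le) (β := β) (by rw [div_mul_eq_mul_div]; gcongr)
    · convert hW using 3 with x
      simp only [powerProfile]
      rw [← Real.rpow_mul (hρ x), ← Real.rpow_mul (hρ x), one_div_mul_eq_div, one_div_mul_eq_div]
    · rw [Finset.sum_div]
      refine Finset.sum_congr rfl fun j _ => ?_
      rw [PiLp.smul_apply, smul_eq_mul, abs_mul, abs_inv,
        abs_of_pos (Real.rpow_pos_of_pos hv _), Real.mul_rpow (by positivity) (abs_nonneg _),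
        Real.inv_rpow (by positivity), ← Real.rpow_mul hv.le, one_div_mul_cancel hP.ne',
        Real.rpow_one, div_eq_inv_mul]

lemma lpAbs_nonneg {d : ℕ} (p : ENNReal) (x : EuclideanSpace ℝ (Fin d)) : 0 ≤ lpAbs p x := by
  unfold lpAbs
  split_ifs
  · exact Real.iSup_nonneg fun j => abs_nonneg _
  · positivity

theorem mainTheorem7 (d : ℕ) (hd : 1 ≤ d) (p : ENNReal) (hp : 0 < p)
    (α β γ : ℝ) (hα : 0 ≤ α) (f₀ : ℝ → ℝ)
    (hf₀ : ∀ t : ℝ, 0 ≤ t → (0 < t ∨ 0 ≤ γ) → f₀ t = t ^ γ / (1 + t ^ α) ^ β) :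
    (fun x : EuclideanSpace ℝ (Fin d) => (f₀ (lpAbs p x) : ℂ)) ∈ wienerAlgebra d ↔
      0 < α ∧ γ < α * β ∧ 0 ≤ γ := by
  constructor
  · intro h
    have hW : IsWiener fun x : EuclideanSpace ℝ (Fin d) => (f₀ (lpAbs p x) : ℂ) := h
    have hray : ∀ t > 0, f₀ (lpAbs p (EuclideanSpace.single (⟨0, hd⟩ : Fin d) t))
        = powerProfile α γ β t := fun t ht => by
      rw [lpAbs_single hp, abs_of_pos ht, hf₀ t ht.le (Or.inl ht), powerProfile_eq_div ht.le]
    obtain ⟨C, hC⟩ := hW.bounded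
    have hγ : 0 ≤ γ := nonneg_of_powerProfile_le (α := α) (β := β) (C := C) hα fun t ht => by
      have := hC (EuclideanSpace.single ⟨0, hd⟩ t)
      rwa [hray t ht, Complex.norm_real] at this
    have hαβ : γ < α * β := by
      refine lt_mul_of_tendsto_powerProfile hα hγ ?_
      have hto : Tendsto (fun t : ℝ => EuclideanSpace.single (⟨0, hd⟩ : Fin d) t) atTop
          (cocompact (EuclideanSpace ℝ (Fin d))) := by
        rw [← Metric.cobounded_eq_cocompact, ← tendsto_norm_atTop_iff_cobounded]
        simp only [PiLp.norm_single, Real.norm_eq_abs]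
        exact tendsto_abs_atTop_atTop
      have h1 := (Complex.continuous_re.tendsto 0).comp (hW.tendsto_zero.comp hto)
      refine h1.congr' ?_
      filter_upwards [eventually_gt_atTop 0] with t ht
      simp only [Function.comp, Complex.ofReal_re]
      exact hray t ht
    refine ⟨hα.lt_of_ne fun h0 => ?_, hαβ, hγ⟩
    rw [← h0, zero_mul] at hαβ
    linarith
  · rintro ⟨hα, hαβ, hγ⟩
    have hW := isWiener_powerProfile_lpAbs hd hp hα hαβ hγ
    have e : (fun x : EuclideanSpace ℝ (Fin d) => (f₀ (lpAbs p x) : ℂ))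
        = fun x => (powerProfile α γ β (lpAbs p x) : ℂ) := by
      funext x
      rw [hf₀ _ (lpAbs_nonneg p x) (Or.inr hγ), powerProfile_eq_div (lpAbs_nonneg p x)]
    rw [e]
    exact hW
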